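/- Let $G$ be a locally compact Hausdorff étale groupoid with unit space $G^{(0)}$, source and range maps $s,r$, and $G_x=s^{-1}(x)$ for $x\in G^{(0)}$. Let $C_c(G)$ be the $*$-algebra with product $(f*g)(\gamma)=\sum_{\alpha\in G_{s(\gamma)}}f(\gamma\alpha^{-1})g(\alpha)$ and involution $f^*(\gamma)=\overline{f(\gamma^{-1})}$. The reduced $C^*$-algebra $C^*_r(G)$ is its completion in $\|f\|_r=\sup_{x\in G^{(0)}}\|\lambda_x(f)\|$, where $(\lambda_x(f)\xi)(\gamma)=\sum_{\alpha\in G_x}f(\gamma\alpha^{-1})\xi(\alpha)$ for $\xi\in\ell^2(G_x)$. The maximal $C^*$-algebra $C^*(G)$ is its completion in $\|f\|_{\max}=\sup_\pi\|\pi(f)\|$, where $\pi$ runs over all $*$-representations of $C_c(G)$ on Hilbert spaces that are contractive for $\|f\|_I=\max\{\sup_x\sum_{\gamma\in G_x}|f(\gamma)|,\ \sup_x\sum_{\gamma\in G_x}|f^*(\gamma)|\}$. Suppose that $G$ has the weak containment property, i.e. the canonical quotient map $q\colon C^*(G)\to C^*_r(G)$, which is the identity on $C_c(G)$, is an isomorphism.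 A bisection is a set $B\subseteq G$ such that $s|_B$ and $r|_B$ are homeomorphisms onto their images; put $\alpha_B=r\circ(s|_B)^{-1}\colon s(B)\to r(B)$ and $\mathrm{Fix}(\alpha_B)=\{x\in s(B):\alpha_B(x)=x\}$. Let $\mu$ be a Radon probability measure on $G^{(0)}$ that is invariant, i.e. $\mu|_{r(B)}=(\alpha_B)_*(\mu|_{s(B)})$ for every open bisection $B$. A tracial state on $C^*_r(G)$ is a state $\tau$ with $\tau(ab)=\tau(ba)$ for all $a,b$; its associated measure is the Radon probability measure $\mu_\tau$ on $G^{(0)}$ with $\tau(f)=\int f\,d\mu_\tau$ for all $f\in C_0(G^{(0)})\subseteq C^*_r(G)$. Let $E\colon C^*_r(G)\to C_0(G^{(0)})$, $E(a)(u)=\langle\lambda_u(a)\delta_u,\delta_u\rangle$, be the canonical conditional expectation; $\tau$ is called canonical if $\tau(a)=\int_{G^{(0)}}E(a)\,d\mu_\tau$ for all $a\in C^*_r(G)$. Then the following are equivalent: (1) $G$ is essentially free with respect to $\mu$, i.e. $\mu(\mathrm{Fix}(\alpha_B))=0$ for every pre-compact open bisection $B\subseteq G\setminus G^{(0)}$;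 (2) every tracial state on $C^*_r(G)$ with associated measure $\mu$ is canonical. -/

import Mathlib

open scoped ENNReal CompactlySupported ComplexOrder ZeroAtInfty lp
open MeasureTheory Topology Filter
noncomputable section
namespace GroupoidCStar

set_option linter.unusedSectionVars false

/-! ### Operators on `ℓ²` given by matrices with bounded absolute row and column sums -/

lemma enorm_sum_sq_le {ι : Type*} (k : ι → ℂ) (ξ : ι → ℂ) :
    (∑' a, ‖k a * ξ a‖ₑ) ^ 2 ≤ (∑' a, ‖k a‖ₑ) * ∑' a, ‖k a‖ₑ * ‖ξ a‖ₑ ^ 2 := by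
  set R : ℝ≥0∞ := (∑' a, ‖k a‖ₑ) * ∑' a, ‖k a‖ₑ * ‖ξ a‖ₑ ^ 2
  suffices h : ∑' a, ‖k a * ξ a‖ₑ ≤ R ^ ((2 : ℝ)⁻¹) by
    have := (ENNReal.le_rpow_inv_iff (by norm_num : (0 : ℝ) < 2)).1 h
    exact_mod_cast this
  refine ENNReal.summable.tsum_le_of_sum_le fun s => ?_
  rw [ENNReal.le_rpow_inv_iff (by norm_num : (0 : ℝ) < 2)]
  have h1 : (∑ a ∈ s, ‖k a * ξ a‖₊) ^ 2 ≤
      (∑ a ∈ s, ‖k a‖₊) * ∑ a ∈ s, ‖k a‖₊ * ‖ξ a‖₊ ^ 2 :=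
    Finset.sum_sq_le_sum_mul_sum_of_sq_le_mul s (fun _ _ => zero_le) (fun _ _ => zero_le)
      (fun a _ => le_of_eq (by rw [nnnorm_mul]; ring))
  have h2 : (∑ a ∈ s, ‖k a * ξ a‖ₑ) ^ 2 ≤
      (∑ a ∈ s, ‖k a‖ₑ) * ∑ a ∈ s, ‖k a‖ₑ * ‖ξ a‖ₑ ^ 2 := by
    simp only [enorm_eq_nnnorm]
    exact_mod_cast h1
  calc (∑ a ∈ s, ‖k a * ξ a‖ₑ) ^ (2 : ℝ) = (∑ a ∈ s, ‖k a * ξ a‖ₑ) ^ 2 := by norm_cast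
    _ ≤ _ := h2
    _ ≤ R := mul_le_mul' (ENNReal.sum_le_tsum s) (ENNReal.sum_le_tsum s)

lemma schur_bound {ι : Type*} (k : ι → ι → ℂ) (C : ℝ≥0∞)
    (hrow : ∀ i, ∑' j, ‖k i j‖ₑ ≤ C) (hcol : ∀ j, ∑' i, ‖k i j‖ₑ ≤ C) (ξ : ι → ℂ) :
    ∑' i, ‖∑' j, k i j * ξ j‖ₑ ^ 2 ≤ C ^ 2 * ∑' j, ‖ξ j‖ₑ ^ 2 := by
  have htri : ∀ f : ι → ℂ, ‖∑' j, f j‖ₑ ≤ ∑' j, ‖f j‖ₑ := fun f => enorm_tsum_le_tsum_enorm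
  calc ∑' i, ‖∑' j, k i j * ξ j‖ₑ ^ 2
      ≤ ∑' i, (C * ∑' j, ‖k i j‖ₑ * ‖ξ j‖ₑ ^ 2) := by
        refine ENNReal.tsum_le_tsum fun i => ?_
        calc _ ≤ (∑' j, ‖k i j * ξ j‖ₑ) ^ 2 := by gcongr; exact htri _
          _ ≤ _ := enorm_sum_sq_le _ _
          _ ≤ _ := by gcongr; exact hrow i
    _ = C * ∑' j, ∑' i, ‖k i j‖ₑ * ‖ξ j‖ₑ ^ 2 := by
        rw [ENNReal.tsum_mul_left, ENNReal.tsum_comm]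
    _ ≤ C * ∑' j, C * ‖ξ j‖ₑ ^ 2 := by
        gcongr with j
        rw [ENNReal.tsum_mul_right]
        gcongr
        exact hcol j
    _ = _ := by rw [ENNReal.tsum_mul_left]; ring

lemma memlp_two_iff {ι : Type*} (ξ : ι → ℂ) :
    Memℓp ξ 2 ↔ ∑' j, ‖ξ j‖ₑ ^ 2 ≠ ∞ := by
  rw [memℓp_gen_iff (by norm_num)]
  have : ∀ j, ‖ξ j‖ₑ ^ 2 = ((‖ξ j‖₊ ^ 2 : NNReal) : ℝ≥0∞) := fun j => by
    simp [enorm_eq_nnnorm]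
  simp_rw [this, ENNReal.tsum_coe_ne_top_iff_summable, ← NNReal.summable_coe]
  simp

lemma enorm_sq_lp {ι : Type*} (ξ : ℓ²(ι, ℂ)) : ‖ξ‖ₑ ^ 2 = ∑' j, ‖ξ j‖ₑ ^ 2 := by
  have h := lp.hasSum_norm (p := 2) (by norm_num) ξ
  have h2 : HasSum (fun i => ‖ξ i‖ ^ 2) (‖ξ‖ ^ 2) := by simpa using h
  have h3 : HasSum (fun i => (‖ξ i‖₊ ^ 2 : NNReal)) (‖ξ‖₊ ^ 2) := by
    rw [← NNReal.hasSum_coe]; simpa using h2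
  have h4 := ENNReal.hasSum_coe.2 h3
  rw [← (by simpa [enorm_eq_nnnorm] using h4.tsum_eq : ∑' j, ‖ξ j‖ₑ ^ 2 = ‖ξ‖ₑ ^ 2)]

lemma summable_kernel_row {ι : Type*} {k : ι → ι → ℂ} {C : ℝ≥0∞} (hC : C ≠ ∞)
    (hrow : ∀ i, ∑' j, ‖k i j‖ₑ ≤ C) (ξ : ℓ²(ι, ℂ)) (i : ι) :
    Summable fun j => k i j * ξ j := by
  have hk : Summable fun j => ‖k i j‖ := by
    have := ne_top_of_le_ne_top hC (hrow i)
    simp_rw [enorm_eq_nnnorm, ENNReal.tsum_coe_ne_top_iff_summable] at this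
    simpa using NNReal.summable_coe.2 this
  refine Summable.of_norm_bounded (hk.mul_right ‖ξ‖) fun j => ?_
  rw [norm_mul]
  gcongr
  exact lp.norm_apply_le_norm (by norm_num) ξ j

/-- The bounded operator on `ℓ²(ι)` whose matrix `k` has absolute row and column sums
at most `C < ∞`. -/
def kernelOp {ι : Type*} (k : ι → ι → ℂ) (C : ℝ≥0∞) (hC : C ≠ ∞)
    (hrow : ∀ i, ∑' j, ‖k i j‖ₑ ≤ C) (hcol : ∀ j, ∑' i, ‖k i j‖ₑ ≤ C) :
    ℓ²(ι, ℂ) →L[ℂ] ℓ²(ι, ℂ) :=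
  LinearMap.mkContinuous
    { toFun := fun ξ => ⟨fun i => ∑' j, k i j * ξ j, (memlp_two_iff _).2
        (ne_top_of_le_ne_top (ENNReal.mul_ne_top (by finiteness)
          ((memlp_two_iff _).1 (lp.memℓp ξ))) (schur_bound k C hrow hcol ξ))⟩
      map_add' := fun ξ η => by
        ext i
        change ∑' j, k i j * (ξ j + η j) = ∑' j, k i j * ξ j + ∑' j, k i j * η j
        rw [← (summable_kernel_row hC hrow ξ i).tsum_add (summable_kernel_row hC hrow η i)]
        simp_rw [mul_add]
      map_smul' := fun c ξ => by
        ext i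
        change ∑' j, k i j * (c * ξ j) = c * ∑' j, k i j * ξ j
        rw [← tsum_mul_left]
        congr 1; ext j; ring }
    C.toReal (fun ξ => by
      have h := schur_bound k C hrow hcol ξ
      rw [← enorm_sq_lp, ← mul_pow] at h
      set η : ℓ²(ι, ℂ) := ⟨fun i => ∑' j, k i j * ξ j, (memlp_two_iff _).2
        (ne_top_of_le_ne_top (ENNReal.mul_ne_top (by finiteness)
          ((memlp_two_iff _).1 (lp.memℓp ξ))) (schur_bound k C hrow hcol ξ))⟩ with hη
      have h' : ‖η‖ₑ ^ 2 ≤ (C * ‖ξ‖ₑ) ^ 2 := by rw [enorm_sq_lp]; exact h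
      have h'' : ‖η‖ₑ ≤ C * ‖ξ‖ₑ := (ENNReal.pow_le_pow_left_iff two_ne_zero).1 h'
      have := ENNReal.toReal_mono (by finiteness) h''
      simpa using this)

lemma kernelOp_apply {ι : Type*} (k : ι → ι → ℂ) (C : ℝ≥0∞) (hC : C ≠ ∞)
    (hrow : ∀ i, ∑' j, ‖k i j‖ₑ ≤ C) (hcol : ∀ j, ∑' i, ‖k i j‖ₑ ≤ C) (ξ : ℓ²(ι, ℂ)) (i : ι) :
    kernelOp k C hC hrow hcol ξ i = ∑' j, k i j * ξ j := rfl

lemma kernelOp_enorm_le {ι : Type*} (k : ι → ι → ℂ) (C : ℝ≥0∞) (hC : C ≠ ∞)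
    (hrow : ∀ i, ∑' j, ‖k i j‖ₑ ≤ C) (hcol : ∀ j, ∑' i, ‖k i j‖ₑ ≤ C) :
    ‖kernelOp k C hC hrow hcol‖ₑ ≤ C := by
  have : ‖kernelOp k C hC hrow hcol‖ ≤ C.toReal :=
    LinearMap.mkContinuous_norm_le _ ENNReal.toReal_nonneg _
  rw [← ofReal_norm]
  exact (ENNReal.ofReal_le_ofReal this).trans_eq (ENNReal.ofReal_toReal hC)

open Classical in
/-- The standard basis vector `δ_j` of `ℓ²(ι)`. -/
def delta {ι : Type*} (j : ι) : ℓ²(ι, ℂ) := lp.single 2 j 1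

lemma inner_delta_left {ι : Type*} (j : ι) (ξ : ℓ²(ι, ℂ)) : inner ℂ (delta j) ξ = ξ j := by
  classical
  rw [delta, lp.inner_single_left]; simp

lemma inner_delta_right {ι : Type*} (j : ι) (ξ : ℓ²(ι, ℂ)) :
    inner ℂ ξ (delta j) = starRingEnd ℂ (ξ j) := by
  rw [← inner_conj_symm, inner_delta_left]

lemma op_ext {ι : Type*} {S T : ℓ²(ι, ℂ) →L[ℂ] ℓ²(ι, ℂ)}
    (h : ∀ i j, S (delta j) i = T (delta j) i) : S = T := by
  classical
  refine lp.ext_continuousLinearMap (by norm_num) fun j => ?_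
  ext1
  ext i
  exact h i j

lemma kernelOp_delta {ι : Type*} (k : ι → ι → ℂ) (C : ℝ≥0∞) (hC : C ≠ ∞)
    (hrow : ∀ i, ∑' j, ‖k i j‖ₑ ≤ C) (hcol : ∀ j, ∑' i, ‖k i j‖ₑ ≤ C) (i j : ι) :
    kernelOp k C hC hrow hcol (delta j) i = k i j := by
  classical
  rw [kernelOp_apply, tsum_eq_single j]
  · simp [delta]
  · intro b hb
    simp [delta, hb]

/-! ### Étale groupoids -/

/-- A groupoid, given by its set `G` of arrows. The units are the arrows `x` with `src x = x`;
the product `γ * η` carries a meaning only when `src γ = rng η`, and its values on the other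
pairs are irrelevant. -/
class ArrowGroupoid (G : Type*) extends Mul G, Inv G where
  src : G → G
  rng : G → G
  src_src : ∀ γ, src (src γ) = src γ
  rng_src : ∀ γ, rng (src γ) = src γ
  src_rng : ∀ γ, src (rng γ) = rng γ
  rng_rng : ∀ γ, rng (rng γ) = rng γ
  src_mul : ∀ γ η, src γ = rng η → src (γ * η) = src η
  rng_mul : ∀ γ η, src γ = rng η → rng (γ * η) = rng γ
  assoc : ∀ γ η ζ, src γ = rng η → src η = rng ζ → γ * η * ζ = γ * (η * ζ)
  mul_src : ∀ γ, γ * src γ = γ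
  rng_mul_self : ∀ γ, rng γ * γ = γ
  src_inv : ∀ γ, src γ⁻¹ = rng γ
  rng_inv : ∀ γ, rng γ⁻¹ = src γ
  inv_mul_self : ∀ γ, γ⁻¹ * γ = src γ
  mul_inv_self : ∀ γ, γ * γ⁻¹ = rng γ

open ArrowGroupoid

/-- The unit space `G⁰`, a subset of `G` with the subspace topology. -/
def unitSpace (G : Type*) [ArrowGroupoid G] : Set G := {x | src x = x}

/-- The source map `G → G⁰`. -/
def s {G : Type*} [ArrowGroupoid G] (γ : G) : unitSpace G := ⟨src γ, src_src γ⟩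

/-- The range map `G → G⁰`. -/
def r {G : Type*} [ArrowGroupoid G] (γ : G) : unitSpace G := ⟨rng γ, src_rng γ⟩

/-- The fibre `G_x = s⁻¹(x)`. -/
abbrev fiber {G : Type*} [ArrowGroupoid G] (x : unitSpace G) : Type _ := {γ : G // s γ = x}

/-- An étale topological groupoid: inversion, range, source and composition of composable pairs
are continuous, and the range map `G → G⁰` is a local homeomorphism. -/
class IsEtale (G : Type*) [TopologicalSpace G] [ArrowGroupoid G] : Prop where
  continuous_inv : Continuous fun γ : G => γ⁻¹
  continuous_src : Continuous (src : G → G)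
  continuous_rng : Continuous (rng : G → G)
  continuousOn_mul : ContinuousOn (fun p : G × G => p.1 * p.2) {p | src p.1 = rng p.2}
  isLocalHomeomorph_r : IsLocalHomeomorph (r : G → unitSpace G)

section algebra
variable {G : Type*} [ArrowGroupoid G]

lemma s_eq_iff {γ η : G} : s γ = s η ↔ src γ = src η := Subtype.ext_iff
lemma s_eq_coe {γ : G} {x : unitSpace G} : s γ = x ↔ src γ = x := Subtype.ext_iff

lemma s_unit (x : unitSpace G) : s (x : G) = x := Subtype.ext x.2

lemma rng_unit (x : unitSpace G) : rng (x : G) = x := by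
  have := rng_src (x : G); rwa [show src (x : G) = x from x.2] at this

lemma inv_unit (x : unitSpace G) : (x : G)⁻¹ = x := by
  have h1 := inv_mul_self (x : G)
  have h2 := mul_src ((x : G)⁻¹)
  rw [src_inv, rng_unit, h1] at h2
  rw [← h2]; exact x.2

lemma arrow_inv_inv (γ : G) : γ⁻¹⁻¹ = γ := by
  calc γ⁻¹⁻¹ = γ⁻¹⁻¹ * src γ⁻¹⁻¹ := (mul_src _).symm
    _ = γ⁻¹⁻¹ * (γ⁻¹ * γ) := by rw [src_inv, rng_inv, inv_mul_self]
    _ = γ⁻¹⁻¹ * γ⁻¹ * γ := (assoc _ _ _ (by rw [src_inv]) (by rw [src_inv])).symm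
    _ = γ := by rw [inv_mul_self, src_inv, rng_mul_self]

lemma arrow_mul_inv_cancel {γ η : G} (h : src γ = rng η) : γ * η * η⁻¹ = γ := by
  rw [assoc _ _ _ h (by rw [rng_inv]), mul_inv_self, ← h, mul_src]

lemma arrow_inv_mul_cancel {γ η : G} (h : src γ = src η) : γ * η⁻¹ * η = γ := by
  rw [assoc _ _ _ (by rw [rng_inv, h]) (by rw [src_inv]), inv_mul_self, ← h, mul_src]

lemma arrow_mul_inv_rev {γ η : G} (h : src γ = rng η) : (γ * η)⁻¹ = η⁻¹ * γ⁻¹ := by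
  have e1 : src η⁻¹ = rng γ⁻¹ := by rw [src_inv, rng_inv, h]
  have e2 : src (γ * η) = src η := src_mul _ _ h
  have e3 : rng (γ * η) = rng γ := rng_mul _ _ h
  have e4 : src (η⁻¹ * γ⁻¹) = rng γ := by rw [src_mul _ _ e1, src_inv]
  have e5 : (η⁻¹ * γ⁻¹) * (γ * η) = src η := by
    rw [assoc _ _ _ e1 (by rw [src_inv, e3]), ← assoc _ _ _ (by rw [src_inv]) h, inv_mul_self,
      h, rng_mul_self, inv_mul_self]
  calc (γ * η)⁻¹ = rng (γ * η)⁻¹ * (γ * η)⁻¹ := (rng_mul_self _).symm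
    _ = (η⁻¹ * γ⁻¹) * (γ * η) * (γ * η)⁻¹ := by rw [rng_inv, e2, e5]
    _ = η⁻¹ * γ⁻¹ := arrow_mul_inv_cancel (by rw [e4, e3])

lemma tsum_fiber_eq {K : Set G} (F : Finset G) (σ : G → unitSpace G → G) (x : unitSpace G)
    (h1 : ∀ a ∈ F, s (σ a x) = x) (h2 : Set.InjOn (fun a => σ a x) F)
    (h3 : ∀ β ∈ K, s β = x → ∃ a ∈ F, σ a x = β) (h : G → ℂ) (hh : ∀ γ ∉ K, h γ = 0) :
    ∑' α : fiber x, h α = ∑ a ∈ F, h (σ a x) := by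
  classical
  rw [tsum_eq_sum (s := F.attach.image fun a : {a // a ∈ F} => (⟨σ a x, h1 a a.2⟩ : fiber x))]
  · rw [Finset.sum_image, Finset.sum_attach F (fun a => h (σ a x))]
    intro a _ b _ hab
    exact Subtype.ext (h2 a.2 b.2 (congrArg Subtype.val hab))
  · intro β hβ
    apply hh
    intro hK
    obtain ⟨a, ha, hab⟩ := h3 β hK β.2
    exact hβ (Finset.mem_image.2 ⟨⟨a, ha⟩, Finset.mem_attach _ _, Subtype.ext hab⟩)

end algebra

section topology
variable {G : Type*} [TopologicalSpace G] [ArrowGroupoid G] [IsEtale G]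

/-- Inversion as a homeomorphism. -/
def invHomeo (G : Type*) [TopologicalSpace G] [ArrowGroupoid G] [IsEtale G] : G ≃ₜ G where
  toFun γ := γ⁻¹
  invFun γ := γ⁻¹
  left_inv := arrow_inv_inv
  right_inv := arrow_inv_inv
  continuous_toFun := IsEtale.continuous_inv
  continuous_invFun := IsEtale.continuous_inv

lemma isLocalHomeomorph_s : IsLocalHomeomorph (s : G → unitSpace G) := by
  have : (s : G → unitSpace G) = r ∘ invHomeo G := by
    ext γ; exact (rng_inv γ).symm
  rw [this]
  exact IsEtale.isLocalHomeomorph_r.comp (invHomeo G).isLocalHomeomorph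

lemma continuous_s : Continuous (s : G → unitSpace G) := isLocalHomeomorph_s.continuous

lemma isClosed_unitSpace [T2Space G] : IsClosed (unitSpace G) :=
  isClosed_eq IsEtale.continuous_src continuous_id

lemma isOpen_unitSpace : IsOpen (unitSpace G) := by
  rw [isOpen_iff_mem_nhds]
  intro x hx
  obtain ⟨e, hxe, he⟩ := isLocalHomeomorph_s (G := G) x
  have h1 : e.source ∈ 𝓝 x := e.open_source.mem_nhds hxe
  have h2 : src ⁻¹' e.source ∈ 𝓝 x := by
    refine IsEtale.continuous_src.continuousAt.preimage_mem_nhds ?_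
    rw [show src x = x from hx]; exact h1
  filter_upwards [h1, h2] with γ hγ hγ'
  refine e.injOn hγ' hγ ?_
  rw [← he]
  exact s_eq_iff.2 (src_src γ)

lemma exists_cover {K : Set G} (hK : IsCompact K) :
    ∃ (t : Finset G) (U : G → Set G), K ⊆ ⋃ a ∈ t, U a ∧ ∀ a, Set.InjOn (s : G → unitSpace G) (U a) := by
  choose e he hs using isLocalHomeomorph_s (G := G)
  obtain ⟨t, -, ht⟩ := hK.elim_nhds_subcover (fun a => (e a).source)
    (fun a _ => (e a).open_source.mem_nhds (he a))
  refine ⟨t, fun a => (e a).source, ht, fun a => ?_⟩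
  have := (e a).injOn
  rwa [← hs a] at this

lemma finite_fiber {K : Set G} (hK : IsCompact K) (x : unitSpace G) :
    (K ∩ {γ | s γ = x}).Finite := by
  obtain ⟨t, U, hKU, hU⟩ := exists_cover hK
  refine Set.Finite.subset (t.finite_toSet.biUnion (t := fun a => U a ∩ {γ | s γ = x}) fun a _ => ?_) ?_
  · exact Set.Subsingleton.finite fun γ h η h' => hU a h.1 h'.1 (h.2.trans h'.2.symm)
  · rintro γ ⟨h, h'⟩
    obtain ⟨a, ha, haU⟩ := Set.mem_iUnion₂.1 (hKU h)
    exact Set.mem_iUnion₂.2 ⟨a, ha, haU, h'⟩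

lemma exists_local_sections [T2Space G] {K : Set G} (hK : IsCompact K) (x₀ : unitSpace G) :
    ∃ (F : Finset G) (σ : G → unitSpace G → G), (∀ a ∈ F, ContinuousAt (σ a) x₀) ∧
      ∀ᶠ x in 𝓝 x₀, (∀ a ∈ F, s (σ a x) = x) ∧ Set.InjOn (fun a => σ a x) F ∧
        ∀ β ∈ K, s β = x → ∃ a ∈ F, σ a x = β := by
  choose e he hs using isLocalHomeomorph_s (G := G)
  have hfin := finite_fiber hK x₀
  obtain ⟨V, hV, hdisj⟩ := hfin.t2_separation
  set W : G → Set G := fun a => V a ∩ (e a).source with hW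
  have hWo : ∀ a, IsOpen (W a) := fun a => (hV a).2.inter (e a).open_source
  have hWa : ∀ a, a ∈ W a := fun a => ⟨(hV a).1, he a⟩
  have hF : ∀ a ∈ hfin.toFinset, s a = x₀ := fun a ha => (hfin.mem_toFinset.1 ha).2
  have hσ : ∀ a ∈ hfin.toFinset, ContinuousAt (e a).symm x₀ := fun a ha => by
    refine (e a).continuousAt_symm ?_
    rw [← hF a ha, hs a]
    exact (e a).map_source (he a)
  have hσ' : ∀ a ∈ hfin.toFinset, (e a).symm x₀ = a := fun a ha => by
    rw [← hF a ha]
    conv_lhs => rw [hs a]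
    exact (e a).left_inv (he a)
  refine ⟨hfin.toFinset, fun a => (e a).symm, hσ, ?_⟩
  have h1 : ∀ᶠ x in 𝓝 x₀, ∀ a ∈ hfin.toFinset, (e a).symm x ∈ W a := by
    rw [Filter.eventually_all_finset]
    intro a ha
    refine (hσ a ha).eventually_mem ?_
    rw [hσ' a ha]
    exact (hWo a).mem_nhds (hWa a)
  have h2 : ∀ᶠ x in 𝓝 x₀, ∀ a ∈ hfin.toFinset, x ∈ (e a).target := by
    rw [Filter.eventually_all_finset]
    intro a ha
    refine (e a).open_target.mem_nhds ?_
    rw [← hF a ha, hs a]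
    exact (e a).map_source (he a)
  have hL : IsCompact (K \ ⋃ a ∈ hfin.toFinset, W a) :=
    hK.diff (isOpen_biUnion fun a _ => hWo a)
  have h3 : ∀ᶠ x in 𝓝 x₀, x ∉ s '' (K \ ⋃ a ∈ hfin.toFinset, W a) := by
    refine (hL.image continuous_s).isClosed.isOpen_compl.mem_nhds ?_
    rintro ⟨β, ⟨hβ, hβ'⟩, hsβ⟩
    exact hβ' (Set.mem_iUnion₂.2 ⟨β, hfin.mem_toFinset.2 ⟨hβ, hsβ⟩, hWa β⟩)
  filter_upwards [h1, h2, h3] with x h1 h2 h3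
  refine ⟨fun a ha => ?_, fun a ha b hb hab => ?_, fun β hβ hsβ => ?_⟩
  · have := (e a).right_inv (h2 a ha)
    rwa [← hs a] at this
  · by_contra hne
    have := hdisj (hfin.mem_toFinset.1 ha) (hfin.mem_toFinset.1 hb) hne
    refine Set.disjoint_left.1 this (h1 a ha).1 ?_
    simp only at hab
    rw [hab]
    exact (h1 b hb).1
  · have : β ∈ ⋃ a ∈ hfin.toFinset, W a := by
      by_contra h
      exact h3 ⟨β, ⟨hβ, h⟩, hsβ⟩
    obtain ⟨a, ha, haW⟩ := Set.mem_iUnion₂.1 this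
    refine ⟨a, ha, ?_⟩
    rw [← hsβ]
    conv_lhs => rw [hs a]
    exact (e a).left_inv haW.2

end topology

/-! ### The convolution algebra `C_c(G)` -/

/-- `C_c(G)`, to be equipped with convolution and involution (and not with the pointwise
product that Mathlib puts on `C_c(G, ℂ)`). -/
def ConvAlg (G : Type*) [TopologicalSpace G] : Type _ := C_c(G, ℂ)

namespace ConvAlg
variable {G : Type*} [TopologicalSpace G]
instance : AddCommGroup (ConvAlg G) := inferInstanceAs (AddCommGroup C_c(G, ℂ))
instance : Module ℂ (ConvAlg G) := inferInstanceAs (Module ℂ C_c(G, ℂ))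
instance : FunLike (ConvAlg G) G ℂ := inferInstanceAs (FunLike C_c(G, ℂ) G ℂ)

@[ext] lemma ext {f g : ConvAlg G} (h : ∀ γ, f γ = g γ) : f = g := DFunLike.ext _ _ h
lemma continuous (f : ConvAlg G) : Continuous f := f.toContinuousMap.continuous
lemma hasCompactSupport (f : ConvAlg G) : HasCompactSupport f := f.hasCompactSupport'
@[simp] lemma zero_apply (γ : G) : (0 : ConvAlg G) γ = 0 := rfl
@[simp] lemma add_apply (f g : ConvAlg G) (γ : G) : (f + g) γ = f γ + g γ := rfl
@[simp] lemma smul_apply (c : ℂ) (f : ConvAlg G) (γ : G) : (c • f) γ = c * f γ := rfl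
end ConvAlg

section conv
variable {G : Type*} [TopologicalSpace G] [ArrowGroupoid G] [IsEtale G]

/-- Convolution: `(f * g)(γ) = ∑_{α ∈ G_{s(γ)}} f(γ α⁻¹) g(α)`. -/
def convFun (f g : G → ℂ) (γ : G) : ℂ := ∑' α : fiber (s γ), f (γ * (α : G)⁻¹) * g α

lemma continuous_convFun [T2Space G] (f g : ConvAlg G) : Continuous (convFun f g) := by
  rw [continuous_iff_continuousAt]
  intro γ₀
  obtain ⟨F, σ, hσ, hev⟩ := exists_local_sections g.hasCompactSupport.isCompact (s γ₀)
  have hev' := continuous_s.continuousAt.eventually hev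
  have heq : (fun γ => ∑ a ∈ F, f (γ * (σ a (s γ))⁻¹) * g (σ a (s γ))) =ᶠ[𝓝 γ₀] convFun f g := by
    filter_upwards [hev'] with γ hγ
    refine (tsum_fiber_eq F σ (s γ) hγ.1 hγ.2.1 hγ.2.2 (fun α => f (γ * α⁻¹) * g α) ?_).symm
    intro α hα
    rw [image_eq_zero_of_notMem_tsupport hα, mul_zero]
  refine ContinuousAt.congr ?_ heq
  refine tendsto_finsetSum _ fun a ha => ?_
  have hσa : ContinuousAt (fun γ => σ a (s γ)) γ₀ :=
    ContinuousAt.comp (f := s) (hσ a ha) continuous_s.continuousAt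
  refine Tendsto.mul ?_ (g.continuous.continuousAt.comp hσa)
  refine (f.continuous.tendsto _).comp ?_
  have hmem : ∀ γ, s (σ a (s γ)) = s γ →
      (γ, (σ a (s γ))⁻¹) ∈ {p : G × G | src p.1 = rng p.2} := fun γ h => by
    change src γ = rng (σ a (s γ))⁻¹
    rw [rng_inv]; exact (s_eq_iff.1 h).symm
  have hc := IsEtale.continuousOn_mul (G := G) (γ₀, (σ a (s γ₀))⁻¹)
    (hmem _ (hev'.self_of_nhds.1 a ha))
  refine Tendsto.comp (g := fun p : G × G => p.1 * p.2)
    (f := fun γ => (γ, (σ a (s γ))⁻¹)) hc (tendsto_nhdsWithin_iff.2 ⟨?_, ?_⟩)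
  · exact ContinuousAt.prodMk continuousAt_id
      (ContinuousAt.comp (f := fun γ => σ a (s γ)) IsEtale.continuous_inv.continuousAt hσa)
  · filter_upwards [hev'] with γ hγ
    exact hmem γ (hγ.1 a ha)

lemma hasCompactSupport_convFun [T2Space G] (f g : ConvAlg G) :
    HasCompactSupport (convFun f g) := by
  set P : Set (G × G) := (tsupport f ×ˢ tsupport g) ∩ {p | src p.1 = rng p.2} with hP
  have hPc : IsCompact P :=
    (f.hasCompactSupport.isCompact.prod g.hasCompactSupport.isCompact).inter_right
      (isClosed_eq (IsEtale.continuous_src.comp continuous_fst)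
        (IsEtale.continuous_rng.comp continuous_snd))
  refine HasCompactSupport.intro
    (hPc.image_of_continuousOn (IsEtale.continuousOn_mul.mono Set.inter_subset_right)) ?_
  intro γ hγ
  unfold convFun
  convert tsum_zero with α
  by_contra hne
  have hα : src γ = src (α : G) := (s_eq_iff.1 α.2).symm
  refine hγ ⟨(γ * (α : G)⁻¹, (α : G)), ⟨⟨?_, ?_⟩, ?_⟩, ?_⟩
  · exact subset_tsupport _ (left_ne_zero_of_mul hne)
  · exact subset_tsupport _ (right_ne_zero_of_mul hne)
  · change src (γ * (α : G)⁻¹) = rng (α : G)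
    rw [src_mul _ _ (by rw [rng_inv, hα]), src_inv]
  · exact arrow_inv_mul_cancel hα

instance [T2Space G] : Mul (ConvAlg G) where
  mul f g := ⟨⟨convFun f g, continuous_convFun f g⟩, hasCompactSupport_convFun f g⟩

/-- The involution `f^*(γ) = conj (f(γ⁻¹))`. -/
instance : Star (ConvAlg G) where
  star f := ⟨⟨fun γ => starRingEnd ℂ (f γ⁻¹),
      Complex.continuous_conj.comp (f.continuous.comp IsEtale.continuous_inv)⟩,
    (f.hasCompactSupport.comp_homeomorph (invHomeo G)).comp_left (map_zero _)⟩

lemma ConvAlg.mul_apply [T2Space G] (f g : ConvAlg G) (γ : G) :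
    (f * g) γ = ∑' α : fiber (s γ), f (γ * (α : G)⁻¹) * g α := rfl

lemma ConvAlg.star_apply (f : ConvAlg G) (γ : G) : (star f) γ = starRingEnd ℂ (f γ⁻¹) := rfl

end conv

/-! ### The `I`-norm and the left regular representations -/

/-- The `I`-norm of a function on `G`, as an extended nonnegative real
(recall `|f^*(γ)| = |f(γ⁻¹)|`). -/
def iNorm {G : Type*} [ArrowGroupoid G] (f : G → ℂ) : ℝ≥0∞ :=
  max (⨆ x : unitSpace G, ∑' γ : fiber x, ‖f γ‖ₑ)
    (⨆ x : unitSpace G, ∑' γ : fiber x, ‖starRingEnd ℂ (f (γ : G)⁻¹)‖ₑ)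

section regular
variable {G : Type*} [ArrowGroupoid G]

/-- For `γ ∈ G_x`, right translation is a bijection from `G_x` onto `G_{r(γ)}`. -/
def fiberEquiv {x : unitSpace G} (γ : fiber x) : fiber x ≃ fiber (r (γ : G)) where
  toFun α := ⟨α * (γ : G)⁻¹, Subtype.ext (by
    change src ((α : G) * (γ : G)⁻¹) = rng (γ : G)
    rw [src_mul _ _ (by rw [rng_inv, s_eq_iff.1 (α.2.trans γ.2.symm)]), src_inv])⟩
  invFun β := ⟨β * (γ : G), Subtype.ext (by
    change src ((β : G) * (γ : G)) = x
    rw [src_mul _ _ (congrArg Subtype.val β.2), s_eq_coe.1 γ.2])⟩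
  left_inv α := Subtype.ext (arrow_inv_mul_cancel (s_eq_iff.1 (α.2.trans γ.2.symm)))
  right_inv β := Subtype.ext (arrow_mul_inv_cancel (congrArg Subtype.val β.2))

lemma iNorm_row (f : G → ℂ) (x : unitSpace G) (γ : fiber x) :
    ∑' α : fiber x, ‖f (γ * (α : G)⁻¹)‖ₑ ≤ iNorm f := by
  have h : ∀ α : fiber x, (γ : G) * (α : G)⁻¹ = (fiberEquiv γ α : G)⁻¹ := fun α => by
    change _ = ((α : G) * (γ : G)⁻¹)⁻¹
    rw [arrow_mul_inv_rev (by rw [rng_inv, s_eq_iff.1 (α.2.trans γ.2.symm)]), arrow_inv_inv]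
  simp_rw [h]
  rw [(fiberEquiv γ).tsum_eq (fun β : fiber (r (γ : G)) => ‖f (β : G)⁻¹‖ₑ)]
  refine le_trans ?_ (le_max_right _ _)
  refine le_trans (le_of_eq ?_) (le_iSup _ (r (γ : G)))
  simp

lemma iNorm_col (f : G → ℂ) (x : unitSpace G) (α : fiber x) :
    ∑' γ : fiber x, ‖f (γ * (α : G)⁻¹)‖ₑ ≤ iNorm f := by
  change ∑' γ : fiber x, ‖f (fiberEquiv α γ : G)‖ₑ ≤ iNorm f
  rw [(fiberEquiv α).tsum_eq (fun β : fiber (r (α : G)) => ‖f (β : G)‖ₑ)]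
  exact le_trans (le_iSup (fun x : unitSpace G => ∑' γ : fiber x, ‖f γ‖ₑ) (r (α : G)))
    (le_max_left _ _)

/-- The operator `(λ_x(f) ξ)(γ) = ∑_{α ∈ G_x} f(γ α⁻¹) ξ(α)` on `ℓ²(G_x)`, for any function `f`
on `G` of finite `I`-norm. -/
def regularOp (x : unitSpace G) (f : G → ℂ) (hf : iNorm f ≠ ∞) :
    ℓ²(fiber x, ℂ) →L[ℂ] ℓ²(fiber x, ℂ) :=
  kernelOp (fun γ α : fiber x => f (γ * (α : G)⁻¹)) (iNorm f) hf (iNorm_row f x) (iNorm_col f x)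

lemma regularOp_apply (x : unitSpace G) (f : G → ℂ) (hf : iNorm f ≠ ∞) (ξ : ℓ²(fiber x, ℂ))
    (γ : fiber x) : regularOp x f hf ξ γ = ∑' α : fiber x, f (γ * (α : G)⁻¹) * ξ α := rfl

lemma regularOp_enorm_le (x : unitSpace G) (f : G → ℂ) (hf : iNorm f ≠ ∞) :
    ‖regularOp x f hf‖ₑ ≤ iNorm f := kernelOp_enorm_le _ _ _ _ _

lemma regularOp_delta (x : unitSpace G) (f : G → ℂ) (hf : iNorm f ≠ ∞) (γ α : fiber x) :
    regularOp x f hf (delta α) γ = f (γ * (α : G)⁻¹) := kernelOp_delta _ _ _ _ _ _ _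

variable [TopologicalSpace G] [IsEtale G]

lemma exists_fiber_bound (f : G → ℂ) (hf : Continuous f) (hs : HasCompactSupport f) :
    ∃ C : ℝ≥0∞, C ≠ ∞ ∧ ∀ x : unitSpace G, ∑' γ : fiber x, ‖f γ‖ₑ ≤ C := by
  obtain ⟨t, U, hKU, hU⟩ := exists_cover hs.isCompact
  obtain ⟨M, hM⟩ := hf.bounded_above_of_compact_support hs
  have hM' : ∀ γ, ‖f γ‖ₑ ≤ ENNReal.ofReal M := fun γ => by
    rw [← ofReal_norm]; exact ENNReal.ofReal_le_ofReal (hM γ)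
  refine ⟨∑ a ∈ t, ENNReal.ofReal M, by simp [ENNReal.mul_eq_top], fun x => ?_⟩
  classical
  calc ∑' γ : fiber x, ‖f γ‖ₑ
      ≤ ∑' γ : fiber x, ∑ a ∈ t, if (γ : G) ∈ U a then ‖f γ‖ₑ else 0 := by
        refine ENNReal.tsum_le_tsum fun γ => ?_
        by_cases h : f γ = 0
        · simp [h]
        · obtain ⟨a, ha, haU⟩ := Set.mem_iUnion₂.1 (hKU (subset_tsupport _ h))
          refine le_trans ?_ (Finset.single_le_sum (fun _ _ => zero_le) ha)
          simp [haU]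
    _ = ∑ a ∈ t, ∑' γ : fiber x, if (γ : G) ∈ U a then ‖f γ‖ₑ else 0 :=
        Summable.tsum_finsetSum fun _ _ => ENNReal.summable
    _ ≤ _ := by
        refine Finset.sum_le_sum fun a _ => ?_
        by_cases h : ∃ γ : fiber x, (γ : G) ∈ U a
        · obtain ⟨γ, hγ⟩ := h
          rw [tsum_eq_single γ]
          · simp [hγ, hM']
          · intro β hβ
            rw [if_neg]
            intro hβU
            exact hβ (Subtype.ext (hU a hβU hγ (β.2.trans γ.2.symm)))
        · push Not at h
          simp [h]

lemma ConvAlg.iNorm_ne_top (f : ConvAlg G) : iNorm f ≠ ∞ := by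
  obtain ⟨C, hC, h⟩ := exists_fiber_bound f f.continuous f.hasCompactSupport
  obtain ⟨D, hD, h'⟩ := exists_fiber_bound (star f : ConvAlg G) (star f : ConvAlg G).continuous
    (star f : ConvAlg G).hasCompactSupport
  exact ne_top_of_le_ne_top (max_lt hC.lt_top hD.lt_top).ne
    (max_le_max (iSup_le h) (iSup_le h'))

/-- The left regular operator `λ_x(f)` for `f ∈ C_c(G)`. -/
def regOp (x : unitSpace G) (f : ConvAlg G) : ℓ²(fiber x, ℂ) →L[ℂ] ℓ²(fiber x, ℂ) :=
  regularOp x f f.iNorm_ne_top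

lemma regOp_delta (x : unitSpace G) (f : ConvAlg G) (γ α : fiber x) :
    regOp x f (delta α) γ = f (γ * (α : G)⁻¹) := regularOp_delta _ _ _ _ _

lemma regOp_injective {f g : ConvAlg G} (h : ∀ x, regOp x f = regOp x g) : f = g := by
  ext γ
  have e : ∀ f : ConvAlg G,
      regOp (s γ) f (delta ⟨s γ, s_unit _⟩) ⟨γ, rfl⟩ = f γ := fun f => by
    rw [regOp_delta]
    change f (γ * (s γ : G)⁻¹) = f γ
    rw [inv_unit]
    exact congrArg f (mul_src γ)
  rw [← e f, ← e g, h]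

lemma regOp_add (x : unitSpace G) (f g : ConvAlg G) : regOp x (f + g) = regOp x f + regOp x g := by
  refine op_ext fun γ α => ?_
  rw [_root_.add_apply, lp.coeFn_add, Pi.add_apply]
  simp only [regOp_delta]; rfl

lemma regOp_smul (x : unitSpace G) (c : ℂ) (f : ConvAlg G) : regOp x (c • f) = c • regOp x f := by
  refine op_ext fun γ α => ?_
  rw [_root_.smul_apply, lp.coeFn_smul, Pi.smul_apply]
  simp only [regOp_delta]; rfl

lemma regOp_zero (x : unitSpace G) : regOp x (0 : ConvAlg G) = 0 := by
  refine op_ext fun γ α => ?_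
  rw [regOp_delta]; rfl

lemma regOp_mul [T2Space G] (x : unitSpace G) (f g : ConvAlg G) :
    regOp x (f * g) = regOp x f * regOp x g := by
  refine op_ext fun γ α => ?_
  rw [mul_apply_eq_comp, regOp_delta]
  conv_rhs => rw [regOp, regularOp_apply]
  simp only [regOp_delta]
  rw [ConvAlg.mul_apply]
  have hx : src (γ : G) = src (α : G) := s_eq_iff.1 (γ.2.trans α.2.symm)
  have hγα : src (γ : G) = rng (α : G)⁻¹ := by rw [rng_inv, hx]
  have hs : s ((γ : G) * (α : G)⁻¹) = r (α : G) := Subtype.ext (by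
    change src ((γ : G) * (α : G)⁻¹) = rng (α : G)
    rw [src_mul _ _ hγα, src_inv])
  rw [hs, ← (fiberEquiv α).tsum_eq]
  congr 1
  ext β
  change f ((γ : G) * (α : G)⁻¹ * ((β : G) * (α : G)⁻¹)⁻¹) * g ((β : G) * (α : G)⁻¹) = _
  have hβα : src (β : G) = rng (α : G)⁻¹ := by rw [rng_inv, s_eq_iff.1 (β.2.trans α.2.symm)]
  rw [arrow_mul_inv_rev hβα, arrow_inv_inv, ← assoc, arrow_inv_mul_cancel hx]
  · rw [src_mul _ _ hγα, src_inv]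
  · rw [rng_inv, s_eq_iff.1 (β.2.trans α.2.symm)]

lemma regOp_star (x : unitSpace G) (f : ConvAlg G) : regOp x (star f) = star (regOp x f) := by
  refine op_ext fun γ α => ?_
  rw [← inner_delta_left γ (star (regOp x f) (delta α)), ContinuousLinearMap.star_eq_adjoint,
    ContinuousLinearMap.adjoint_inner_right, inner_delta_right, regOp_delta, regOp_delta]
  have e : (γ : G) * (α : G)⁻¹ = ((α : G) * (γ : G)⁻¹)⁻¹ := by
    rw [arrow_mul_inv_rev (by rw [rng_inv, s_eq_iff.1 (α.2.trans γ.2.symm)]), arrow_inv_inv]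
  rw [ConvAlg.star_apply, e, arrow_inv_inv]

lemma regOp_enorm_le (x : unitSpace G) (f : ConvAlg G) : ‖regOp x f‖ₑ ≤ iNorm f :=
  regularOp_enorm_le _ _ _

end regular

section star_algebra
variable {G : Type*} [TopologicalSpace G] [T2Space G] [ArrowGroupoid G] [IsEtale G]

instance : NonUnitalRing (ConvAlg G) where
  left_distrib f g h := regOp_injective fun x => by simp [regOp_mul, regOp_add, mul_add]
  right_distrib f g h := regOp_injective fun x => by simp [regOp_mul, regOp_add, add_mul]
  zero_mul f := regOp_injective fun x => by simp [regOp_mul, regOp_zero]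
  mul_zero f := regOp_injective fun x => by simp [regOp_mul, regOp_zero]
  mul_assoc f g h := regOp_injective fun x => by simp [regOp_mul, mul_assoc]

instance : IsScalarTower ℂ (ConvAlg G) (ConvAlg G) where
  smul_assoc c f g := regOp_injective fun x => by simp [regOp_mul, regOp_smul]

instance : SMulCommClass ℂ (ConvAlg G) (ConvAlg G) where
  smul_comm c f g := regOp_injective fun x => by simp [regOp_mul, regOp_smul]

instance : StarRing (ConvAlg G) where
  star_involutive f := regOp_injective fun x => by simp [regOp_star]
  star_mul f g := regOp_injective fun x => by simp [regOp_star, regOp_mul]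
  star_add f g := regOp_injective fun x => by simp [regOp_star, regOp_add]

instance : StarModule ℂ (ConvAlg G) where
  star_smul c f := regOp_injective fun x => by simp [regOp_star, regOp_smul]

/-- The left regular representation `λ_x : C_c(G) → B(ℓ²(G_x))`. -/
def leftRegular (x : unitSpace G) : ConvAlg G →⋆ₙₐ[ℂ] (ℓ²(fiber x, ℂ) →L[ℂ] ℓ²(fiber x, ℂ)) where
  toFun := regOp x
  map_smul' := regOp_smul x
  map_zero' := regOp_zero x
  map_add' := regOp_add x
  map_mul' := regOp_mul x
  map_star' := regOp_star x

end star_algebra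

/-! ### The reduced and the maximal groupoid C*-algebra -/

section extend
variable {G : Type*} [ArrowGroupoid G]

open Classical in
/-- Extension of a function on `G⁰` by zero to `G`. -/
def extendZero (f : unitSpace G → ℂ) (γ : G) : ℂ := if h : γ ∈ unitSpace G then f ⟨γ, h⟩ else 0

lemma extendZero_coe (f : unitSpace G → ℂ) (x : unitSpace G) : extendZero f x = f x := by
  simp [extendZero]

lemma extendZero_of_notMem (f : unitSpace G → ℂ) {γ : G} (h : γ ∉ unitSpace G) :
    extendZero f γ = 0 := by simp [extendZero, h]

end extend

section cstar
universe u
variable (G : Type u) [TopologicalSpace G] [T2Space G] [ArrowGroupoid G] [IsEtale G]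

/-- A `*`-representation of `C_c(G)` on a Hilbert space that is contractive for the `I`-norm;
by continuity these are the contractive `*`-representations of the completion `L¹(G)`.
(Hilbert spaces in the universe of `G` suffice: cyclic representations live on completions of
quotients of `C_c(G)`.) -/
structure ContractiveRep : Type (u + 1) where
  H : Type u
  [instNACG : NormedAddCommGroup H]
  [instIPS : InnerProductSpace ℂ H]
  [instComplete : CompleteSpace H]
  π : ConvAlg G →⋆ₙₐ[ℂ] (H →L[ℂ] H)
  contractive : ∀ f, ‖π f‖ₑ ≤ iNorm f

attribute [instance] ContractiveRep.instNACG ContractiveRep.instIPS ContractiveRep.instComplete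

variable {G}

/-- The left regular representation at `x`, as a contractive representation. -/
def leftRegularRep (x : unitSpace G) : ContractiveRep G where
  H := ℓ²(fiber x, ℂ)
  π := leftRegular x
  contractive := regOp_enorm_le x

lemma memlp_infty_of_enorm_le {ι : Type*} {E : ι → Type*} [∀ i, NormedAddCommGroup (E i)]
    (a : ∀ i, E i) (C : ℝ≥0∞) (hC : C ≠ ∞) (h : ∀ i, ‖a i‖ₑ ≤ C) : Memℓp a ∞ := by
  refine memℓp_infty ⟨C.toReal, ?_⟩
  rintro _ ⟨i, rfl⟩
  simpa using ENNReal.toReal_mono hC (h i)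

variable (G)

/-- The C*-algebra `∏_x B(ℓ²(G_x))` of bounded families of operators, with the supremum norm. -/
def RegularProduct : Type u :=
  lp (fun x : unitSpace G => ℓ²(fiber x, ℂ) →L[ℂ] ℓ²(fiber x, ℂ)) ∞

/-- The C*-algebra of bounded families of operators indexed by all contractive representations. -/
def UniversalProduct : Type (u + 1) := lp (fun ρ : ContractiveRep G => ρ.H →L[ℂ] ρ.H) ∞

instance : NonUnitalCStarAlgebra (RegularProduct G) := inferInstanceAs (NonUnitalCStarAlgebra
  (lp (fun x : unitSpace G => ℓ²(fiber x, ℂ) →L[ℂ] ℓ²(fiber x, ℂ)) ∞))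

instance : NonUnitalCStarAlgebra (UniversalProduct G) := inferInstanceAs (NonUnitalCStarAlgebra
  (lp (fun ρ : ContractiveRep G => ρ.H →L[ℂ] ρ.H) ∞))

variable {G}

/-- The component of a family at `x`. -/
def RegularProduct.coord (a : RegularProduct G) (x : unitSpace G) :
    ℓ²(fiber x, ℂ) →L[ℂ] ℓ²(fiber x, ℂ) := a.1 x

/-- The component of a family at `ρ`. -/
def UniversalProduct.coord (a : UniversalProduct G) (ρ : ContractiveRep G) :
    ρ.H →L[ℂ] ρ.H := a.1 ρ

@[ext] lemma RegularProduct.ext {a b : RegularProduct G} (h : ∀ x, a.coord x = b.coord x) :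
    a = b := lp.ext (funext h)

@[ext] lemma UniversalProduct.ext {a b : UniversalProduct G} (h : ∀ ρ, a.coord ρ = b.coord ρ) :
    a = b := lp.ext (funext h)

lemma RegularProduct.norm_coord_le (a : RegularProduct G) (x : unitSpace G) :
    ‖a.coord x‖ ≤ ‖a‖ :=
  lp.norm_apply_le_norm (E := fun x : unitSpace G => ℓ²(fiber x, ℂ) →L[ℂ] ℓ²(fiber x, ℂ))
    ENNReal.top_ne_zero a x

lemma UniversalProduct.norm_coord_le (a : UniversalProduct G) (ρ : ContractiveRep G) :
    ‖a.coord ρ‖ ≤ ‖a‖ :=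
  lp.norm_apply_le_norm (E := fun ρ : ContractiveRep G => ρ.H →L[ℂ] ρ.H)
    ENNReal.top_ne_zero a ρ

lemma RegularProduct.norm_le {a : RegularProduct G} {C : ℝ} (hC : 0 ≤ C)
    (h : ∀ x, ‖a.coord x‖ ≤ C) : ‖a‖ ≤ C :=
  lp.norm_le_of_forall_le (E := fun x : unitSpace G => ℓ²(fiber x, ℂ) →L[ℂ] ℓ²(fiber x, ℂ)) hC h

variable (G)

/-- The direct sum `⊕_x λ_x : C_c(G) → ∏_x B(ℓ²(G_x))`; the target is the C*-algebra of bounded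
families of operators with the supremum norm, so that `‖regularSum f‖ = sup_x ‖λ_x(f)‖`. -/
def regularSum : ConvAlg G →⋆ₙₐ[ℂ] RegularProduct G where
  toFun f := ⟨fun x => leftRegular x f,
    memlp_infty_of_enorm_le _ _ f.iNorm_ne_top (fun x => regOp_enorm_le x f)⟩
  map_smul' c f := RegularProduct.ext fun x => map_smul (leftRegular x) c f
  map_zero' := RegularProduct.ext fun x => map_zero (leftRegular x)
  map_add' f g := RegularProduct.ext fun x => map_add (leftRegular x) f g
  map_mul' f g := RegularProduct.ext fun x => map_mul (leftRegular x) f g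
  map_star' f := RegularProduct.ext fun x => map_star (leftRegular x) f

/-- The direct sum of all contractive `*`-representations, so that `‖universalSum f‖ = ‖f‖_max`
is the supremum of `‖π f‖` over all of them. -/
def universalSum : ConvAlg G →⋆ₙₐ[ℂ] UniversalProduct G where
  toFun f := ⟨fun ρ => ρ.π f, memlp_infty_of_enorm_le _ _ f.iNorm_ne_top (fun ρ => ρ.contractive f)⟩
  map_smul' c f := UniversalProduct.ext fun ρ => map_smul ρ.π c f
  map_zero' := UniversalProduct.ext fun ρ => map_zero ρ.π
  map_add' f g := UniversalProduct.ext fun ρ => map_add ρ.π f g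
  map_mul' f g := UniversalProduct.ext fun ρ => map_mul ρ.π f g
  map_star' f := UniversalProduct.ext fun ρ => map_star ρ.π f

/-- The reduced C*-algebra `C*_r(G)`: the completion of `C_c(G)` in the reduced norm, realised as
the closure of the (isometric) image of `C_c(G)` in the C*-algebra `∏_x B(ℓ²(G_x))`. -/
def reducedSubalgebra : NonUnitalStarSubalgebra ℂ (RegularProduct G) :=
  (NonUnitalStarAlgHom.range (regularSum G)).topologicalClosure

/-- The maximal C*-algebra `C*(G)`: the completion of `C_c(G)` in the maximal norm, realised as
the closure of the (isometric) image of `C_c(G)` in the product of all `B(H)`. -/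
def maximalSubalgebra : NonUnitalStarSubalgebra ℂ (UniversalProduct G) :=
  (NonUnitalStarAlgHom.range (universalSum G)).topologicalClosure

instance : IsClosed (reducedSubalgebra G : Set (RegularProduct G)) := isClosed_closure

instance : IsClosed (maximalSubalgebra G : Set (UniversalProduct G)) := isClosed_closure

/-- `C*_r(G)` as a type. -/
abbrev ReducedCStar : Type u := reducedSubalgebra G

/-- `C*(G)` as a type. -/
abbrev MaximalCStar : Type (u + 1) := maximalSubalgebra G

instance : NonUnitalCStarAlgebra (ReducedCStar G) :=
  NonUnitalStarSubalgebra.nonUnitalCStarAlgebra (reducedSubalgebra G)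

instance : NonUnitalCStarAlgebra (MaximalCStar G) :=
  NonUnitalStarSubalgebra.nonUnitalCStarAlgebra (maximalSubalgebra G)

/-- Restriction of a family indexed by all contractive representations to the `λ_x`. -/
def restrictToRegular : UniversalProduct G →⋆ₙₐ[ℂ] RegularProduct G where
  toFun a := ⟨fun x => a.coord (leftRegularRep x), memℓp_infty ⟨‖a‖, by
    rintro _ ⟨x, rfl⟩
    exact a.norm_coord_le (leftRegularRep x)⟩⟩
  map_smul' _ _ := rfl
  map_zero' := rfl
  map_add' _ _ := rfl
  map_mul' _ _ := rfl
  map_star' _ := rfl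

lemma continuous_restrictToRegular : Continuous (restrictToRegular G) := by
  refine AddMonoidHomClass.continuous_of_bound (restrictToRegular G) 1 fun a => ?_
  rw [one_mul]
  exact RegularProduct.norm_le (norm_nonneg _) fun x => a.norm_coord_le (leftRegularRep x)

lemma restrictToRegular_mem (a : MaximalCStar G) :
    restrictToRegular G a.1 ∈ reducedSubalgebra G := by
  refine map_mem_closure (continuous_restrictToRegular G) a.2 ?_
  rintro _ ⟨f, rfl⟩
  exact ⟨f, rfl⟩

/-- The canonical quotient map `q : C*(G) → C*_r(G)`, the identity on `C_c(G)`. -/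
def canonicalQuotient : MaximalCStar G →⋆ₙₐ[ℂ] ReducedCStar G :=
  NonUnitalStarAlgHom.codRestrict
    ((restrictToRegular G).comp (NonUnitalStarSubalgebraClass.subtype (maximalSubalgebra G)))
    (reducedSubalgebra G) (restrictToRegular_mem G)

/-- The canonical copy of `f ∈ C_c(G)` in `C*_r(G)`. -/
def toReduced (f : ConvAlg G) : ReducedCStar G := ⟨regularSum G f, subset_closure ⟨f, rfl⟩⟩

/-- The canonical copy of `f ∈ C_c(G)` in `C*(G)`. -/
def toMaximal (f : ConvAlg G) : MaximalCStar G := ⟨universalSum G f, subset_closure ⟨f, rfl⟩⟩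

lemma canonicalQuotient_toMaximal (f : ConvAlg G) : canonicalQuotient G (toMaximal G f) = toReduced G f := rfl

lemma norm_toReduced (f : ConvAlg G) : ‖toReduced G f‖ = ⨆ x, ‖leftRegular x f‖ :=
  lp.norm_eq_ciSup (regularSum G f)

lemma norm_toMaximal (f : ConvAlg G) : ‖toMaximal G f‖ = ⨆ ρ : ContractiveRep G, ‖ρ.π f‖ :=
  lp.norm_eq_ciSup (universalSum G f)

lemma toReduced_injective : Function.Injective (toReduced G) := fun _ _ h =>
  regOp_injective fun x => congrArg (fun a : ReducedCStar G => a.1.coord x) h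

/-- The weak containment property: `q : C*(G) → C*_r(G)` is an isomorphism. -/
def WeakContainment : Prop := Function.Bijective (canonicalQuotient G)

variable {G}

/-! ### `C_0(G⁰)` inside `C*_r(G)` and the conditional expectation -/

lemma iNorm_extendZero_le (f : unitSpace G → ℂ) (C : ℝ≥0∞) (hf : ∀ x, ‖f x‖ₑ ≤ C) :
    iNorm (extendZero f) ≤ C := by
  have hC : ∀ γ, ‖extendZero f γ‖ₑ ≤ C := fun γ => by
    by_cases h : γ ∈ unitSpace G
    · exact (congrArg _ (extendZero_coe f ⟨γ, h⟩)).trans_le (hf _)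
    · simp [extendZero_of_notMem f h]
  have hinv : ∀ γ : G, γ ∉ unitSpace G → γ⁻¹ ∉ unitSpace G := fun γ h h' => h (by
    have := inv_unit (⟨γ⁻¹, h'⟩ : unitSpace G)
    simp only [arrow_inv_inv] at this
    rw [this]; exact h')
  have hne : ∀ (x : unitSpace G) (γ : fiber x), γ ≠ ⟨x, s_unit x⟩ → (γ : G) ∉ unitSpace G :=
    fun x γ hγ h => hγ (Subtype.ext ((show src (γ : G) = γ from h).symm.trans (s_eq_coe.1 γ.2)))
  refine max_le (iSup_le fun x => ?_) (iSup_le fun x => ?_)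
  · rw [tsum_eq_single ⟨x, s_unit x⟩]
    · exact hC _
    · intro γ hγ
      rw [extendZero_of_notMem f (hne x γ hγ), enorm_zero]
  · rw [tsum_eq_single ⟨x, s_unit x⟩]
    · simpa using hC _
    · intro γ hγ
      rw [extendZero_of_notMem f (hinv _ (hne x γ hγ)), map_zero, enorm_zero]

lemma iNorm_extendZero_ne_top (f : C₀(unitSpace G, ℂ)) : iNorm (extendZero f) ≠ ∞ := by
  refine ne_top_of_le_ne_top enorm_ne_top (iNorm_extendZero_le f ‖f.toBCF‖ₑ fun x => ?_)
  rw [enorm_le_iff_norm_le]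
  exact f.toBCF.norm_coe_le_norm x

/-- The family `(λ_x(f))_x`, where `f ∈ C_0(G⁰)` is extended by zero to `G`. -/
def unitFunFamily (f : C₀(unitSpace G, ℂ)) : RegularProduct G :=
  ⟨fun x => regularOp x (extendZero f) (iNorm_extendZero_ne_top f),
    memlp_infty_of_enorm_le _ _ (iNorm_extendZero_ne_top f) fun x => regularOp_enorm_le x _ _⟩

lemma continuous_extendZero {f : unitSpace G → ℂ} (hf : Continuous f) :
    Continuous (extendZero f) := by
  classical
  rw [continuous_iff_continuousAt]
  intro γ
  by_cases h : γ ∈ unitSpace G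
  · have : ContinuousAt (extendZero f ∘ ((↑) : unitSpace G → G)) ⟨γ, h⟩ := by
      refine hf.continuousAt.congr (Eventually.of_forall fun x => (extendZero_coe f x).symm)
    exact (isOpen_unitSpace.isOpenEmbedding_subtypeVal.continuousAt_iff).1 this
  · refine (continuousAt_const (y := (0 : ℂ))).congr ?_
    filter_upwards [isClosed_unitSpace.isOpen_compl.mem_nhds h] with η hη
    exact (extendZero_of_notMem f hη).symm

lemma exists_approx (f : C₀(unitSpace G, ℂ)) {ε : ℝ} (hε : 0 < ε) :
    ∃ g : ConvAlg G, ∃ d : unitSpace G → ℂ, (∀ x, ‖d x‖ ≤ 2 * ε) ∧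
      ∀ γ, extendZero f γ - g γ = extendZero d γ := by
  set χ : ℂ → ℂ := fun z => ((max 0 (min 1 (‖z‖ / ε - 1)) : ℝ) : ℂ) with hχ
  have hχc : Continuous χ := by fun_prop
  have hcpt : IsCompact {x : unitSpace G | ε ≤ ‖f x‖} := by
    have h := f.zero_at_infty'
    have h2 : {x : unitSpace G | ‖f x‖ < ε} ∈ cocompact (unitSpace G) := by
      have := h (Metric.ball_mem_nhds (0 : ℂ) hε)
      filter_upwards [this] with x hx
      simpa using hx
    obtain ⟨K, hK, hK'⟩ := mem_cocompact.1 h2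
    refine hK.of_isClosed_subset (isClosed_le continuous_const (by fun_prop)) fun x hx => ?_
    by_contra hxK
    exact not_lt.2 (show ε ≤ ‖f x‖ from hx) (hK' hxK)
  have hsmall : ∀ z : ℂ, ‖z‖ < ε → χ z = 0 := fun z hz => by
    have : ‖z‖ / ε < 1 := (div_lt_one hε).2 hz
    have h : min 1 (‖z‖ / ε - 1) ≤ 0 := (min_le_right _ _).trans (by linarith)
    simp [hχ, max_eq_left h]
  have hfc := continuous_extendZero (G := G) f.continuous
  refine ⟨⟨⟨fun γ => extendZero f γ * χ (extendZero f γ), hfc.mul (hχc.comp hfc)⟩, ?_⟩,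
    fun x => f x - f x * χ (f x), fun x => ?_, fun γ => ?_⟩
  · refine HasCompactSupport.intro (hcpt.image continuous_subtype_val) fun γ hγ => ?_
    by_cases h : γ ∈ unitSpace G
    · have e : extendZero f γ = f ⟨γ, h⟩ := extendZero_coe f ⟨γ, h⟩
      have : ‖f ⟨γ, h⟩‖ < ε := by
        by_contra hlt
        exact hγ ⟨⟨γ, h⟩, not_lt.1 hlt, rfl⟩
      change extendZero f γ * χ (extendZero f γ) = 0
      rw [e, hsmall _ this, mul_zero]
    · change extendZero f γ * χ (extendZero f γ) = 0
      rw [extendZero_of_notMem f h, zero_mul]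
  · set t : ℝ := max 0 (min 1 (‖f x‖ / ε - 1)) with ht
    have ht0 : 0 ≤ t := le_max_left _ _
    have ht1 : t ≤ 1 := max_le zero_le_one (min_le_left _ _)
    have e : f x - f x * χ (f x) = f x * ((1 - t : ℝ) : ℂ) := by
      simp only [hχ, ← ht]; push_cast; ring
    change ‖f x - f x * χ (f x)‖ ≤ _
    rw [e, norm_mul, Complex.norm_real, Real.norm_of_nonneg (by linarith)]
    by_cases h : ‖f x‖ ≤ 2 * ε
    · nlinarith [norm_nonneg (f x)]
    · have h1 : 1 ≤ ‖f x‖ / ε - 1 := by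
        have : 2 ≤ ‖f x‖ / ε := (le_div_iff₀ hε).2 (not_le.1 h).le
        linarith
      have : t = 1 := by rw [ht, min_eq_left h1]; simp
      rw [this]; simp; positivity
  · change extendZero f γ - extendZero f γ * χ (extendZero f γ) = _
    by_cases h : γ ∈ unitSpace G
    · lift γ to unitSpace G using h
      simp only [extendZero_coe]
    · simp [extendZero_of_notMem _ h]

lemma unitFunFamily_mem (f : C₀(unitSpace G, ℂ)) : unitFunFamily f ∈ reducedSubalgebra G := by
  change unitFunFamily f ∈ closure (Set.range (regularSum G))
  rw [Metric.mem_closure_range_iff]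
  intro ε hε
  obtain ⟨g, d, hd, hgd⟩ := exists_approx f (ε := ε / 4) (by positivity)
  refine ⟨g, ?_⟩
  rw [dist_eq_norm]
  refine lt_of_le_of_lt (b := 2 * (ε / 4)) ?_ (by linarith)
  refine RegularProduct.norm_le (by positivity) fun x => ?_
  have hle : iNorm (extendZero d) ≤ ENNReal.ofReal (2 * (ε / 4)) :=
    iNorm_extendZero_le d _ fun y => by
      rw [← ofReal_norm]; exact ENNReal.ofReal_le_ofReal (hd y)
  have hne : iNorm (extendZero d) ≠ ∞ := ne_top_of_le_ne_top ENNReal.ofReal_ne_top hle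
  have e : (unitFunFamily f - regularSum G g).coord x = regularOp x (extendZero d) hne := by
    refine op_ext fun γ α => ?_
    rw [regularOp_delta, ← hgd]
    change regularOp x (extendZero f) (iNorm_extendZero_ne_top f) (delta α) γ - regOp x g (delta α) γ = _
    congr 1
    · exact regularOp_delta _ _ _ _ _
    · exact regOp_delta _ _ _ _
  rw [e]
  have := (regularOp_enorm_le x (extendZero d) hne).trans hle
  rwa [← ofReal_norm, ENNReal.ofReal_le_ofReal_iff (by positivity)] at this

/-- The inclusion `ι : C_0(G⁰) → C*_r(G)`, extending a function by zero off `G⁰`. -/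
def unitInclusion (f : C₀(unitSpace G, ℂ)) : ReducedCStar G :=
  ⟨unitFunFamily f, unitFunFamily_mem f⟩

/-- The conditional expectation `E(a)(u) = ⟨λ_u(a) δ_u, δ_u⟩` (the scalar product of Mathlib is
linear in the second variable). -/
def unitExpectation (a : ReducedCStar G) (u : unitSpace G) : ℂ :=
  inner ℂ (delta (⟨u, s_unit u⟩ : fiber u)) (a.1.coord u (delta ⟨u, s_unit u⟩))

end cstar

/-- A tracial state on a C*-algebra: a positive linear functional of norm one with
`τ(ab) = τ(ba)`. -/
structure IsTracialState {A : Type*} [NonUnitalCStarAlgebra A] (τ : A →L[ℂ] ℂ) : Prop where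
  nonneg : ∀ a, 0 ≤ τ (star a * a)
  norm_eq_one : ‖τ‖ = 1
  tracial : ∀ a b, τ (a * b) = τ (b * a)

/-! ### Bisections, invariant measures, essential freeness -/

section bisection
variable {G : Type*} [TopologicalSpace G] [ArrowGroupoid G]

/-- `B` is a bisection: the restrictions of `s` and `r` to `B` are homeomorphisms onto their
images. -/
def IsBisection (B : Set G) : Prop :=
  IsEmbedding (fun γ : B => s (γ : G)) ∧ IsEmbedding (fun γ : B => r (γ : G))

/-- `α_B : s(B) → G⁰`, `x ↦ r((s|_B)⁻¹(x))`, for a bisection `B`. -/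
def bisectionMap (B : Set G) (x : s '' B) : unitSpace G := r x.2.choose

/-- The fixed points of `α_B`. -/
def fixedPoints (B : Set G) : Set (unitSpace G) :=
  {x | ∃ h : x ∈ s '' B, bisectionMap B ⟨x, h⟩ = x}

variable [MeasurableSpace (unitSpace G)]

/-- `μ` is invariant: `μ|_{r(B)} = (α_B)_* (μ|_{s(B)})` for every open bisection `B`. -/
def IsInvariant (μ : Measure (unitSpace G)) : Prop :=
  ∀ B : Set G, IsOpen B → IsBisection B →
    μ.restrict (r '' B) = (μ.comap ((↑) : s '' B → unitSpace G)).map (bisectionMap B)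

/-- `G` is essentially free with respect to `μ`: `μ(Fix(α_B)) = 0` for every pre-compact open
bisection `B ⊆ G \ G⁰`. -/
def IsEssentiallyFree (μ : Measure (unitSpace G)) : Prop :=
  ∀ B : Set G, IsOpen B → IsBisection B → IsCompact (closure B) → B ⊆ (unitSpace G)ᶜ →
    μ (fixedPoints B) = 0

variable [T2Space G] [IsEtale G]

/-- `μ` is the associated measure of the functional `τ` on `C*_r(G)`: `τ(f) = ∫ f dμ` for all
`f ∈ C_0(G⁰)`. -/
def IsAssociatedMeasure (τ : ReducedCStar G →L[ℂ] ℂ) (μ : Measure (unitSpace G)) : Prop :=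
  ∀ f : C₀(unitSpace G, ℂ), τ (unitInclusion f) = ∫ x, f x ∂μ

/-- `τ_μ(a) = ∫ E(a) dμ`. -/
def traceOf (μ : Measure (unitSpace G)) (a : ReducedCStar G) : ℂ := ∫ u, unitExpectation a u ∂μ

/-- `τ` is canonical: `τ = τ_μ` for the associated Radon probability measure `μ` of `τ`. -/
def IsCanonical (τ : ReducedCStar G →L[ℂ] ℂ) : Prop :=
  ∃ μ : Measure (unitSpace G), IsProbabilityMeasure μ ∧ μ.Regular ∧
    IsAssociatedMeasure τ μ ∧ ∀ a, τ a = traceOf μ a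

end bisection

end GroupoidCStar
end

open GroupoidCStar MeasureTheory

/-! Traces see only the isotropy. If `g ∈ C_c(G)` is supported where source and range lie in
disjoint open sets, a cutoff `h ∈ C_c(G⁰)` can be chosen with `g * h = g` and `h * g = 0`, so `τ(g)
= τ(g * h) = τ(h * g) = 0`. A partition of unity extends this to every `f` whose support misses `{s
= r}` (`eq_zero_of_tsupport_off_isotropy`).

(1) ⇒ (2). By density and a partition of unity it suffices to compare `τ` with `∫ E dμ` on functions
supported in `G⁰` or in a small pre-compact open bisection `B` off `G⁰`. On the former they agree
because `μ` is the associated measure. On the latter `E` vanishes. The sources of the isotropy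
arrows in `supp f` form a compact subset of `Fix(α_B)`, hence a null set. Cut `f` with a function
`χ` on `G⁰` that is `1` near this set and supported in an open set of small measure. The part `f ·
(1 - χ ∘ s)` lives off the isotropy and is killed by `τ`. Cauchy–Schwarz bounds `|τ(f * χ)|²` by
`τ(f * f^*) ∫ χ² dμ`, which is arbitrarily small (`eq_zero_of_fixedPoints_null`).

(2) ⇒ (1). The hypothesis is tested on the trace `f ↦ ∫ ∑ f(γ) dμ(x)`, the sum being over the
isotropy group at `x`. The inner sum is the coefficient at `δ_x` of the representation of `C_c(G)`
on `ℓ²(G⁰)` that moves `δ_{s(γ)}` to `δ_{r(γ)}`. Its matrix satisfies the row and column bounds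
given by the `I`-norm, so it extends to `C*(G)`, and weak containment carries it over to `C*_r(G)`.
Invariance of `μ` makes the integral a trace (`integral_arrowSum_mul_comm`). If `μ(Fix(α_B)) > 0`
for some open bisection `B` off `G⁰`, choose a compact `K ⊆ Fix(α_B)` of positive measure and a bump
function `f` on `B` equal to `1` on the arrows over `K`. Then `E(f) = 0`, while the trace of `f` is
at least `μ(K)`, so this trace is not canonical (`measure_fixedPoints_eq_zero`). -/

noncomputable section
namespace GroupoidCStar
open ArrowGroupoid

set_option linter.unusedSectionVars false

/-! ### Pointwise multiplication and local induction on `C_c(G)` -/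

section pmul
variable {G : Type*} [TopologicalSpace G]

/-- Pointwise product of `f ∈ C_c(G)` with a continuous real function. -/
def ConvAlg.pmul (φ : C(G, ℝ)) (f : ConvAlg G) : ConvAlg G :=
  ⟨⟨fun γ => (φ γ : ℂ) * f γ, (Complex.continuous_ofReal.comp φ.continuous).mul f.continuous⟩,
    f.hasCompactSupport.mul_left⟩

@[simp] lemma ConvAlg.pmul_apply (φ : C(G, ℝ)) (f : ConvAlg G) (γ : G) :
    f.pmul φ γ = φ γ * f γ := rfl

lemma ConvAlg.tsupport_pmul_subset (φ : C(G, ℝ)) (f : ConvAlg G) :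
    tsupport (f.pmul φ) ⊆ tsupport φ ∩ tsupport f := by
  refine Set.subset_inter (closure_mono fun γ hγ => ?_) (closure_mono fun γ hγ => ?_)
  · exact fun h => hγ (by simp [h])
  · exact fun h => hγ (by simp [h])

lemma ConvAlg.sum_apply {ι : Type*} (t : Finset ι) (f : ι → ConvAlg G) (γ : G) :
    (∑ i ∈ t, f i) γ = ∑ i ∈ t, f i γ := by
  classical
  induction t using Finset.induction_on with
  | empty => simp
  | insert a t ha ih => rw [Finset.sum_insert ha, Finset.sum_insert ha, ConvAlg.add_apply, ih]

/-- An additive property of functions in `C_c(G)` holds for `f` if each point of the support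
of `f` has a neighbourhood `U` such that the property holds for the functions supported in
`U ∩ supp f`. -/
lemma ConvAlg.local_induction [T2Space G] [LocallyCompactSpace G] {P : ConvAlg G → Prop}
    (zero : P 0) (add : ∀ f g, P f → P g → P (f + g)) (f : ConvAlg G)
    (loc : ∀ γ ∈ tsupport f, ∃ U : Set G, IsOpen U ∧ γ ∈ U ∧
      ∀ g : ConvAlg G, tsupport g ⊆ U → tsupport g ⊆ tsupport f → P g) : P f := by
  choose! U hUo hU hP using loc
  obtain ⟨t, ht, hcov⟩ := f.hasCompactSupport.isCompact.elim_nhds_subcover U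
    fun γ hγ => (hUo γ hγ).mem_nhds (hU γ hγ)
  -- The partition of unity is taken over a cover indexed by `Fin n`.
  set e := t.equivFin
  obtain ⟨φ, hφ, hsum, -, -⟩ := exists_continuous_sum_one_of_isOpen_isCompact
    (s := fun i => U (e.symm i)) (fun i => hUo _ (ht _ (e.symm i).2))
    f.hasCompactSupport.isCompact (by
      intro γ hγ
      obtain ⟨a, ha, haU⟩ := Set.mem_iUnion₂.1 (hcov hγ)
      exact Set.mem_iUnion.2 ⟨e ⟨a, ha⟩, by simpa using haU⟩)
  have hf : f = ∑ i, f.pmul (φ i) := by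
    ext γ
    simp only [ConvAlg.sum_apply, ConvAlg.pmul_apply]
    rw [← Finset.sum_mul]
    by_cases h : γ ∈ tsupport f
    · have := hsum h
      simp only [Finset.sum_apply, Pi.one_apply] at this
      rw [← Complex.ofReal_sum, this]; simp
    · rw [image_eq_zero_of_notMem_tsupport h, mul_zero]
  rw [hf]
  refine Finset.sum_induction _ P add zero fun i _ => ?_
  have h := f.tsupport_pmul_subset (φ i)
  exact hP _ (ht _ (e.symm i).2) _ (fun γ hγ => hφ i (h hγ).1) (fun γ hγ => (h hγ).2)

end pmul

/-! ### Bisections, and the action of `C_c(G⁰)` on `C_c(G)` from both sides -/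

section units

lemma s_inv {G : Type*} [ArrowGroupoid G] (γ : G) : s γ⁻¹ = r γ := Subtype.ext (src_inv γ)
lemma r_inv {G : Type*} [ArrowGroupoid G] (γ : G) : r γ⁻¹ = s γ := Subtype.ext (rng_inv γ)
lemma r_unit {G : Type*} [ArrowGroupoid G] (x : unitSpace G) : r (x : G) = x :=
  Subtype.ext (rng_unit x)

variable {G : Type*} [TopologicalSpace G] [ArrowGroupoid G]

variable [IsEtale G]

lemma continuous_r : Continuous (r : G → unitSpace G) :=
  IsEtale.isLocalHomeomorph_r.continuous

lemma isOpenMap_s : IsOpenMap (s : G → unitSpace G) := isLocalHomeomorph_s.isOpenMap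
lemma isOpenMap_r : IsOpenMap (r : G → unitSpace G) := IsEtale.isLocalHomeomorph_r.isOpenMap

/-- An open set on which `s` and `r` are injective is a bisection. -/
lemma isBisection_of_injOn {B : Set G} (hB : IsOpen B) (hs : B.InjOn s) (hr : B.InjOn r) :
    IsBisection B :=
  ⟨(IsOpenEmbedding.of_continuous_injective_isOpenMap (continuous_s.comp continuous_subtype_val)
      hs.injective (isOpenMap_s.comp hB.isOpenMap_subtype_val)).isEmbedding,
    (IsOpenEmbedding.of_continuous_injective_isOpenMap (continuous_r.comp continuous_subtype_val)
      hr.injective (isOpenMap_r.comp hB.isOpenMap_subtype_val)).isEmbedding⟩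

lemma IsBisection.injOn_s {B : Set G} (h : IsBisection B) : B.InjOn s :=
  Set.injOn_iff_injective.2 h.1.injective

lemma IsBisection.injOn_r {B : Set G} (h : IsBisection B) : B.InjOn r :=
  Set.injOn_iff_injective.2 h.2.injective

lemma IsBisection.mono {B C : Set G} (h : IsBisection B) (hC : IsOpen C) (hCB : C ⊆ B) :
    IsBisection C := isBisection_of_injOn hC (h.injOn_s.mono hCB) (h.injOn_r.mono hCB)

lemma exists_isOpen_bisection (γ : G) : ∃ U : Set G, IsOpen U ∧ γ ∈ U ∧ IsBisection U := by
  obtain ⟨e, he, hs⟩ := isLocalHomeomorph_s (G := G) γ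
  obtain ⟨e', he', hr⟩ := IsEtale.isLocalHomeomorph_r (G := G) γ
  refine ⟨e.source ∩ e'.source, e.open_source.inter e'.open_source, ⟨he, he'⟩,
    isBisection_of_injOn (e.open_source.inter e'.open_source) ?_ ?_⟩
  · rw [hs]; exact e.injOn.mono Set.inter_subset_left
  · rw [hr]; exact e'.injOn.mono Set.inter_subset_right

/-- Injectivity of `s` on `B` forces the chosen preimage to be `γ`. Computations with `α_B` can
thereby be carried out on arrows. -/
lemma bisectionMap_s {B : Set G} (hB : IsBisection B) {γ : G} (hγ : γ ∈ B)
    (h : s γ ∈ s '' B) : bisectionMap B ⟨s γ, h⟩ = r γ :=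
  congrArg r (hB.injOn_s h.choose_spec.1 hγ h.choose_spec.2)

/-- This links freeness to isotropy: fixed points are the units carrying an isotropy arrow of `B`.
-/
lemma mem_fixedPoints_iff {B : Set G} (hB : IsBisection B) {x : unitSpace G} :
    x ∈ fixedPoints B ↔ ∃ γ ∈ B, s γ = x ∧ r γ = x := by
  constructor
  · rintro ⟨⟨γ, hγ, rfl⟩, h⟩
    exact ⟨γ, hγ, rfl, (bisectionMap_s hB hγ (Set.mem_image_of_mem s hγ)).symm.trans h⟩
  · rintro ⟨γ, hγ, rfl, h⟩
    exact ⟨Set.mem_image_of_mem s hγ, (bisectionMap_s hB hγ _).trans h⟩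

variable [T2Space G]

/-- `f ∈ C_c(G⁰)`, extended by zero, as an element of `C_c(G)`. -/
def unitConv (f : C_c(unitSpace G, ℂ)) : ConvAlg G :=
  ⟨⟨extendZero f, continuous_extendZero f.continuous⟩,
    HasCompactSupport.intro (f.hasCompactSupport'.isCompact.image continuous_subtype_val)
      fun γ hγ => by
        by_cases h : γ ∈ unitSpace G
        · exact (extendZero_coe f ⟨γ, h⟩).trans
            (image_eq_zero_of_notMem_tsupport fun h' => hγ ⟨_, h', rfl⟩)
        · exact extendZero_of_notMem _ h⟩

lemma unitConv_coe (f : C_c(unitSpace G, ℂ)) (x : unitSpace G) : unitConv f x = f x :=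
  extendZero_coe f x

lemma unitConv_of_notMem (f : C_c(unitSpace G, ℂ)) {γ : G} (h : γ ∉ unitSpace G) :
    unitConv f γ = 0 := extendZero_of_notMem f h

/-- The only unit in the fibre over `s γ` is `s γ` itself, so a single term of the convolution
survives. -/
lemma mul_unitConv (f : ConvAlg G) (h : C_c(unitSpace G, ℂ)) (γ : G) :
    (f * unitConv h) γ = f γ * h (s γ) := by
  rw [ConvAlg.mul_apply, tsum_eq_single ⟨s γ, s_unit _⟩]
  · rw [unitConv_coe, inv_unit]
    exact congrArg (fun η => f η * h (s γ)) (mul_src γ)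
  · intro α hα
    rw [unitConv_of_notMem, mul_zero]
    intro h
    exact hα (Subtype.ext ((show src (α : G) = α from h).symm.trans (s_eq_coe.1 α.2)))

lemma unitConv_mul (h : C_c(unitSpace G, ℂ)) (f : ConvAlg G) (γ : G) :
    (unitConv h * f) γ = h (r γ) * f γ := by
  rw [ConvAlg.mul_apply, tsum_eq_single ⟨γ, rfl⟩]
  · change unitConv h (γ * γ⁻¹) * f γ = _
    rw [mul_inv_self]
    exact congrArg (· * f γ) (unitConv_coe h (r γ))
  · intro α hα
    rw [unitConv_of_notMem, zero_mul]
    intro h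
    -- If `γα⁻¹` is a unit, it equals its source `rng α`; hence `γ = (γα⁻¹)α = rng α * α = α`.
    refine hα (Subtype.ext ?_)
    have hs : src γ = src (α : G) := (s_eq_iff.1 α.2).symm
    have hs' : src γ = rng (α : G)⁻¹ := by rw [rng_inv, hs]
    have h1 := rng_unit ⟨_, h⟩
    simp only [rng_mul _ _ hs'] at h1
    have h2 := arrow_inv_mul_cancel hs
    have h3 : src (γ * (α : G)⁻¹) = γ * (α : G)⁻¹ := h
    rw [src_mul _ _ hs', src_inv] at h3
    rw [← h3, rng_mul_self] at h2
    exact h2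

lemma toReduced_add (f g : ConvAlg G) : toReduced G (f + g) = toReduced G f + toReduced G g :=
  Subtype.ext (map_add (regularSum G) f g)

lemma toReduced_zero : toReduced G (0 : ConvAlg G) = 0 := Subtype.ext (map_zero (regularSum G))

lemma toReduced_mul (f g : ConvAlg G) : toReduced G (f * g) = toReduced G f * toReduced G g :=
  Subtype.ext (map_mul (regularSum G) f g)

lemma toReduced_star (f : ConvAlg G) : toReduced G (star f) = star (toReduced G f) :=
  Subtype.ext (map_star (regularSum G) f)

lemma denseRange_toReduced : DenseRange (toReduced G) := by
  intro a
  rw [closure_subtype]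
  have h : Subtype.val '' Set.range (toReduced G) = Set.range (regularSum G) := by
    rw [← Set.range_comp]; rfl
  rw [h]
  exact a.2

/-- A function in `C_c(G⁰)` as an element of `C_0(G⁰)`. -/
def toC0 (f : C_c(unitSpace G, ℂ)) : C₀(unitSpace G, ℂ) :=
  ⟨f.toContinuousMap, f.hasCompactSupport'.is_zero_at_infty⟩

/-- Both sides are built from the same matrices, those of the extension by zero, so the identity is
definitional. -/
lemma toReduced_unitConv (f : C_c(unitSpace G, ℂ)) :
    toReduced G (unitConv f) = unitInclusion (toC0 f) :=
  rfl

lemma unitExpectation_toReduced (f : ConvAlg G) (u : unitSpace G) :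
    unitExpectation (toReduced G f) u = f u := by
  rw [unitExpectation, inner_delta_left]
  refine (regOp_delta u f _ _).trans ?_
  change f ((u : G) * (u : G)⁻¹) = _
  rw [mul_inv_self, rng_unit]

end units

/-! ### Positive functionals -/

section functionals
variable {A : Type*} [NonUnitalCStarAlgebra A]

/-- The functional `a ↦ ⟨Φ(a) ξ, ξ⟩` of a representation `Φ` and a vector `ξ`. -/
def vectorFunctional {H : Type*} [NormedAddCommGroup H] [InnerProductSpace ℂ H] [CompleteSpace H]
    (Φ : A →⋆ₙₐ[ℂ] (H →L[ℂ] H)) (ξ : H) : A →L[ℂ] ℂ :=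
  LinearMap.mkContinuous
    { toFun := fun a => inner ℂ ξ (Φ a ξ)
      map_add' := fun a b => by rw [map_add, _root_.add_apply, inner_add_right]
      map_smul' := fun c a => by rw [map_smul, _root_.smul_apply, inner_smul_right]; rfl }
    (‖ξ‖ * ‖ξ‖) fun a => by
      calc ‖inner ℂ ξ (Φ a ξ)‖ ≤ ‖ξ‖ * ‖Φ a ξ‖ := norm_inner_le_norm _ _
        _ ≤ ‖ξ‖ * (‖a‖ * ‖ξ‖) := by
          gcongr
          exact (Φ a).le_of_opNorm_le (NonUnitalStarAlgHom.norm_apply_le Φ a) ξ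
        _ = _ := by ring

section vectorFunctional
variable {H : Type*} [NormedAddCommGroup H] [InnerProductSpace ℂ H] [CompleteSpace H]
  (Φ : A →⋆ₙₐ[ℂ] (H →L[ℂ] H)) (ξ : H)

lemma vectorFunctional_apply (a : A) : vectorFunctional Φ ξ a = inner ℂ ξ (Φ a ξ) := rfl

lemma norm_vectorFunctional_le : ‖vectorFunctional Φ ξ‖ ≤ ‖ξ‖ * ‖ξ‖ :=
  LinearMap.mkContinuous_norm_le _ (by positivity) _

lemma vectorFunctional_nonneg (a : A) : 0 ≤ vectorFunctional Φ ξ (star a * a) := by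
  rw [vectorFunctional_apply, map_mul, map_star, mul_apply_eq_comp,
    ContinuousLinearMap.star_eq_adjoint, ContinuousLinearMap.adjoint_inner_right]
  have h : inner ℂ (Φ a ξ) (Φ a ξ) = ((‖Φ a ξ‖ ^ 2 : ℝ) : ℂ) := by
    rw [inner_self_eq_norm_sq_to_K]; norm_cast
  rw [h]
  exact Complex.zero_le_real.2 (sq_nonneg _)

end vectorFunctional

/-- The form `(a, b) ↦ τ(a^* b)` is a possibly degenerate inner product, for which the inequality is
standard. -/
lemma cauchy_schwarz_of_nonneg (τ : A →L[ℂ] ℂ) (hτ : ∀ a, 0 ≤ τ (star a * a)) (a b : A) :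
    ‖τ (star a * b)‖ ^ 2 ≤ (τ (star a * a)).re * (τ (star b * b)).re := by
  have him : ∀ a, (τ (star a * a)).im = 0 := fun a => (Complex.nonneg_iff.1 (hτ a)).2.symm
  -- Polarization: since `τ` is real at the squares of `a + b` and `a + i b`, the form is Hermitian.
  -- No unit is needed.
  have hsymm : ∀ a b, starRingEnd ℂ (τ (star b * a)) = τ (star a * b) := fun a b => by
    have h1 := him (a + b)
    have h2 := him (a + Complex.I • b)
    simp only [star_add, add_mul, mul_add, map_add, Complex.add_im, him, star_smul,
      smul_mul_assoc, mul_smul_comm, map_smul, smul_eq_mul, Complex.mul_im, Complex.I_re,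
      Complex.I_im, Complex.star_def, Complex.conj_I, Complex.neg_re, Complex.neg_im,
      Complex.mul_re] at h1 h2
    refine Complex.ext ?_ ?_
    · rw [Complex.conj_re]; linarith
    · rw [Complex.conj_im]; linarith
  let core : PreInnerProductSpace.Core ℂ A :=
    { inner := fun a b => τ (star a * b)
      conj_inner_symm := hsymm
      re_inner_nonneg := fun a => (Complex.nonneg_iff.1 (hτ a)).1
      add_left := fun a b c => by rw [star_add, add_mul, map_add]
      smul_left := fun a b c => by
        rw [star_smul, smul_mul_assoc, map_smul]; rfl }
  have h := @InnerProductSpace.Core.inner_mul_inner_self_le ℂ A _ _ _ core a b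
  change ‖τ (star a * b)‖ * ‖τ (star b * a)‖ ≤ (τ (star a * a)).re * (τ (star b * b)).re at h
  rwa [← hsymm b a, RCLike.norm_conj, ← sq] at h

variable {X : Type*} [MeasurableSpace X]

/-- Each `a` is a limit of a sequence from the dense range, and pointwise limits of measurable
functions are measurable. -/
lemma measurable_apply_of_denseRange {ι : Type*} {j : ι → A} (hj : DenseRange j)
    {φ : X → A →L[ℂ] ℂ} (h : ∀ i, Measurable fun x => φ x (j i)) (a : A) :
    Measurable fun x => φ x a := by
  obtain ⟨u, hu, hlim⟩ := mem_closure_iff_seq_limit.1 (hj a)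
  refine measurable_of_tendsto_metrizable (f := fun n x => φ x (u n)) (fun n => ?_) ?_
  · obtain ⟨i, hi⟩ := hu n
    simpa only [hi] using h i
  · exact tendsto_pi_nhds.2 fun x => ((φ x).continuous.tendsto a).comp hlim

lemma integrable_apply (μ : Measure X) [IsProbabilityMeasure μ] {φ : X → A →L[ℂ] ℂ}
    (hm : ∀ a, Measurable fun x => φ x a) (hb : ∀ x, ‖φ x‖ ≤ 1) (a : A) :
    Integrable (fun x => φ x a) μ :=
  Integrable.of_bound (hm a).aestronglyMeasurable ‖a‖ (Eventually.of_forall fun x => by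
    simpa using (φ x).le_of_opNorm_le (hb x) a)

/-- The functional `∫ φ_x dμ(x)`, for a measurable family of contractive functionals `φ_x`. -/
def integralFunctional (μ : Measure X) [IsProbabilityMeasure μ] (φ : X → A →L[ℂ] ℂ)
    (hm : ∀ a, Measurable fun x => φ x a) (hb : ∀ x, ‖φ x‖ ≤ 1) : A →L[ℂ] ℂ :=
  LinearMap.mkContinuous
    { toFun := fun a => ∫ x, φ x a ∂μ
      map_add' := fun a b => by
        simp only [map_add]
        exact integral_add (integrable_apply μ hm hb a) (integrable_apply μ hm hb b)
      map_smul' := fun c a => by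
        simp only [map_smul]
        exact integral_smul c _ }
    1 fun a => by
      have := norm_integral_le_of_norm_le_const (μ := μ) (f := fun x => φ x a) (C := 1 * ‖a‖)
        (Eventually.of_forall fun x => (φ x).le_of_opNorm_le (hb x) a)
      simpa using this

lemma norm_integralFunctional_le (μ : Measure X) [IsProbabilityMeasure μ] (φ : X → A →L[ℂ] ℂ)
    (hm : ∀ a, Measurable fun x => φ x a) (hb : ∀ x, ‖φ x‖ ≤ 1) :
    ‖integralFunctional μ φ hm hb‖ ≤ 1 := LinearMap.mkContinuous_norm_le _ zero_le_one _

end functionals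

lemma norm_delta {ι : Type*} (j : ι) : ‖(delta j : ℓ²(ι, ℂ))‖ = 1 := by
  classical
  rw [delta, lp.norm_single (by norm_num)]; simp

/-! ### Essential freeness implies that traces are canonical -/

section canonical
variable {G : Type*} [TopologicalSpace G] [T2Space G] [ArrowGroupoid G] [IsEtale G]

/-- The representation `λ_x` of `C*_r(G)`. -/
def reducedCoord (x : unitSpace G) :
    ReducedCStar G →⋆ₙₐ[ℂ] (ℓ²(fiber x, ℂ) →L[ℂ] ℓ²(fiber x, ℂ)) where
  toFun a := a.1.coord x
  map_smul' _ _ := rfl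
  map_zero' := rfl
  map_add' _ _ := rfl
  map_mul' _ _ := rfl
  map_star' _ := rfl

/-- The functional `a ↦ E(a)(x)`. -/
def expectationAt (x : unitSpace G) : ReducedCStar G →L[ℂ] ℂ :=
  vectorFunctional (reducedCoord x) (delta ⟨x, s_unit x⟩)

lemma norm_expectationAt_le (x : unitSpace G) : ‖expectationAt x‖ ≤ 1 := by
  refine (norm_vectorFunctional_le _ _).trans ?_
  rw [norm_delta, one_mul]

lemma expectationAt_toReduced (x : unitSpace G) (f : ConvAlg G) :
    expectationAt x (toReduced G f) = f x := unitExpectation_toReduced f x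

/-- Locally, source and range are separated by disjoint open sets `V` and `W`. A cutoff `h`
supported in `V` acts as `1` on the right of `g` and as `0` on the left, and traciality exchanges
the two. -/
lemma eq_zero_of_tsupport_off_isotropy [LocallyCompactSpace G] {τ : ReducedCStar G →L[ℂ] ℂ}
    (hτ : ∀ a b, τ (a * b) = τ (b * a)) (f : ConvAlg G) (hf : ∀ γ ∈ tsupport f, s γ ≠ r γ) :
    τ (toReduced G f) = 0 := by
  have : LocallyCompactSpace (unitSpace G) := isClosed_unitSpace.locallyCompactSpace
  refine ConvAlg.local_induction (P := fun f => τ (toReduced G f) = 0) ?_ ?_ f fun γ hγ => ?_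
  · rw [toReduced_zero, map_zero]
  · intro f g hf hg
    rw [toReduced_add, map_add, hf, hg, add_zero]
  obtain ⟨V, W, hV, hW, hsV, hrW, hVW⟩ := t2_separation (hf γ hγ)
  refine ⟨s ⁻¹' V ∩ r ⁻¹' W, (hV.preimage continuous_s).inter (hW.preimage continuous_r),
    ⟨hsV, hrW⟩, fun g hg _ => ?_⟩
  obtain ⟨χ, hχ, hχc, hχV, -⟩ := exists_continuousMap_one_of_isCompact_subset_isOpen
    (g.hasCompactSupport.isCompact.image continuous_s) hV
    (Set.image_subset_iff.2 fun η hη => (hg hη).1)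
  let h : C_c(unitSpace G, ℂ) := ⟨⟨fun x => (χ x : ℂ), by fun_prop⟩,
    HasCompactSupport.comp_left (g := ((↑) : ℝ → ℂ)) hχc Complex.ofReal_zero⟩
  have hh : ∀ x, h x = χ x := fun _ => rfl
  have h1 : g * unitConv h = g := by
    ext η
    rw [mul_unitConv, hh]
    by_cases hη : η ∈ tsupport g
    · rw [hχ ⟨η, hη, rfl⟩]; simp
    · rw [image_eq_zero_of_notMem_tsupport hη, zero_mul]
  have h2 : unitConv h * g = 0 := by
    ext η
    rw [unitConv_mul, hh, ConvAlg.zero_apply]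
    by_cases hη : η ∈ tsupport g
    · rw [image_eq_zero_of_notMem_tsupport fun h' => Set.disjoint_left.1 hVW (hχV h') (hg hη).2]
      simp
    · rw [image_eq_zero_of_notMem_tsupport hη, mul_zero]
  rw [← h1, toReduced_mul, hτ, ← toReduced_mul, h2, toReduced_zero, map_zero]

variable [MeasurableSpace (unitSpace G)] [BorelSpace (unitSpace G)]

lemma measurable_expectationAt (a : ReducedCStar G) : Measurable fun x => expectationAt x a := by
  refine measurable_apply_of_denseRange denseRange_toReduced (fun f => ?_) a
  simp only [expectationAt_toReduced]
  exact (f.continuous.comp continuous_subtype_val).measurable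

/-- `τ_μ` as a continuous linear functional. -/
def canonicalTrace (μ : Measure (unitSpace G)) [IsProbabilityMeasure μ] :
    ReducedCStar G →L[ℂ] ℂ :=
  integralFunctional μ expectationAt measurable_expectationAt norm_expectationAt_le

lemma canonicalTrace_toReduced (μ : Measure (unitSpace G)) [IsProbabilityMeasure μ]
    (f : ConvAlg G) : canonicalTrace μ (toReduced G f) = ∫ x : unitSpace G, f x ∂μ := by
  change ∫ x, expectationAt x (toReduced G f) ∂μ = _
  simp only [expectationAt_toReduced]

/-- The isotropy part of `f` sits over a null set. It is cut off by a function of small `L²(μ)`-norm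
and controlled by Cauchy–Schwarz; the rest is off the isotropy and invisible to the trace. -/
lemma eq_zero_of_fixedPoints_null [LocallyCompactSpace G] (μ : Measure (unitSpace G))
    [IsProbabilityMeasure μ] [μ.Regular] {τ : ReducedCStar G →L[ℂ] ℂ} (hτ : IsTracialState τ)
    (hμ : IsAssociatedMeasure τ μ) {B : Set G} (hB : IsBisection B)
    (hfix : μ (fixedPoints B) = 0) (f : ConvAlg G) (hf : tsupport f ⊆ B) :
    τ (toReduced G f) = 0 := by
  have : LocallyCompactSpace (unitSpace G) := isClosed_unitSpace.locallyCompactSpace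
  set L : Set (unitSpace G) := s '' (tsupport f ∩ {γ | s γ = r γ}) with hL
  have hLc : IsCompact L :=
    (f.hasCompactSupport.isCompact.inter_right (isClosed_eq continuous_s continuous_r)).image
      continuous_s
  have hL0 : μ L = 0 := measure_mono_null (by
    rintro _ ⟨γ, ⟨h, h'⟩, rfl⟩
    exact (mem_fixedPoints_iff hB).2 ⟨γ, hf h, rfl, h'.symm⟩) hfix
  -- `M` is `τ(f * f^*)`: Cauchy–Schwarz is applied below to the pair `f^*`, `h`.
  set M := (τ (star (star (toReduced G f)) * star (toReduced G f))).re
  have key : ∀ ε : ℝ, 0 < ε → ‖τ (toReduced G f)‖ ^ 2 ≤ M * ε := by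
    intro ε hε
    obtain ⟨V, hLV, hVo, hVε⟩ := Set.exists_isOpen_lt_of_lt L (ENNReal.ofReal ε)
      (by rw [hL0]; simpa using hε)
    -- With `L` in the interior of `K`, the function `1 - χ ∘ s` vanishes on a neighbourhood of the
    -- isotropy in `supp f`. Thus the closed support of `f.pmul ψ`, and not just its nonzero set,
    -- misses the isotropy.
    obtain ⟨K, hK, hLK, hKV⟩ := exists_compact_between hLc hVo hLV
    obtain ⟨χ, hχ, hχc, hχV, hχ01⟩ := exists_continuousMap_one_of_isCompact_subset_isOpen hK hVo hKV
    let h : C_c(unitSpace G, ℂ) := ⟨⟨fun x => (χ x : ℂ), by fun_prop⟩,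
      HasCompactSupport.comp_left (g := ((↑) : ℝ → ℂ)) hχc Complex.ofReal_zero⟩
    let h' : C_c(unitSpace G, ℂ) := ⟨⟨fun x => (χ x : ℂ) * χ x, by fun_prop⟩,
      HasCompactSupport.comp_left (g := fun t : ℝ => (t : ℂ) * t) hχc (by simp)⟩
    have hh : ∀ x, h x = χ x := fun _ => rfl
    have hh' : ∀ x, h' x = χ x * χ x := fun _ => rfl
    let ψ : C(G, ℝ) := ⟨fun γ => 1 - χ (s γ), by have := continuous_s (G := G); fun_prop⟩
    have hsplit : f = f * unitConv h + f.pmul ψ := by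
      ext γ
      rw [ConvAlg.add_apply, mul_unitConv, ConvAlg.pmul_apply, hh]
      change f γ = f γ * χ (s γ) + ((1 - χ (s γ) : ℝ) : ℂ) * f γ
      push_cast; ring
    have hoff : τ (toReduced G (f.pmul ψ)) = 0 := by
      refine eq_zero_of_tsupport_off_isotropy hτ.tracial _ fun γ hγ hsr => ?_
      have hγK : s γ ∈ interior K := hLK ⟨γ, ⟨(f.tsupport_pmul_subset ψ hγ).2, hsr⟩, rfl⟩
      refine notMem_tsupport_iff_eventuallyEq.2 ?_ hγ
      filter_upwards [continuous_s.continuousAt.preimage_mem_nhds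
        (isOpen_interior.mem_nhds hγK)] with η hη
      have : χ (s η) = 1 := hχ (interior_subset hη)
      change ((1 - χ (s η) : ℝ) : ℂ) * f η = 0
      rw [this]; simp
    -- On functions supported in `G⁰` convolution is the pointwise product and the involution is
    -- conjugation.
    have hsq : star (unitConv h) * unitConv h = unitConv h' := by
      ext γ
      rw [mul_unitConv, ConvAlg.star_apply]
      by_cases hγ : γ ∈ unitSpace G
      · lift γ to unitSpace G using hγ
        rw [inv_unit, unitConv_coe, unitConv_coe, s_unit, hh, hh', Complex.conj_ofReal]
      · rw [unitConv_of_notMem _ hγ, unitConv_of_notMem, map_zero, zero_mul]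
        intro h'
        have := inv_unit ⟨_, h'⟩
        simp only [arrow_inv_inv] at this
        exact hγ (this ▸ h')
    have hint : (τ (star (toReduced G (unitConv h)) * toReduced G (unitConv h))).re ≤ ε := by
      rw [← toReduced_star, ← toReduced_mul, hsq, toReduced_unitConv, hμ]
      refine (Complex.re_le_norm _).trans ?_
      have h0 : ∫ x, toC0 h' x ∂μ = ∫ x in V, toC0 h' x ∂μ := by
        refine (setIntegral_eq_integral_of_forall_compl_eq_zero fun x hx => ?_).symm
        change (χ x : ℂ) * χ x = 0
        rw [image_eq_zero_of_notMem_tsupport fun h => hx (hχV h)]; simp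
      rw [h0]
      refine (norm_setIntegral_le_of_norm_le_const (C := 1) (measure_lt_top _ _)
        fun x _ => ?_).trans ?_
      · change ‖(χ x : ℂ) * χ x‖ ≤ 1
        rw [norm_mul, Complex.norm_real, Real.norm_of_nonneg (hχ01 x).1]
        exact mul_le_one₀ (hχ01 x).2 (hχ01 x).1 (hχ01 x).2
      · rw [one_mul]
        exact ENNReal.toReal_le_of_le_ofReal hε.le hVε.le
    have hM : 0 ≤ M := (Complex.nonneg_iff.1 (hτ.nonneg _)).1
    calc ‖τ (toReduced G f)‖ ^ 2
        = ‖τ (star (star (toReduced G f)) * toReduced G (unitConv h))‖ ^ 2 := by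
          conv_lhs => rw [hsplit]
          rw [toReduced_add, map_add, hoff, add_zero, toReduced_mul, star_star]
      _ ≤ _ := cauchy_schwarz_of_nonneg τ hτ.nonneg _ _
      _ ≤ M * ε := by gcongr
  have h0 : ‖τ (toReduced G f)‖ ^ 2 ≤ 0 := by
    have hlim : Tendsto (fun ε : ℝ => M * ε) (𝓝[>] 0) (𝓝 0) := by
      have : Tendsto (fun ε : ℝ => M * ε) (𝓝 0) (𝓝 (M * 0)) := (continuous_const_mul M).tendsto 0
      rw [mul_zero] at this
      exact this.mono_left nhdsWithin_le_nhds
    exact ge_of_tendsto hlim (eventually_mem_nhdsWithin.mono fun ε hε => key ε hε)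
  exact norm_eq_zero.1 (pow_eq_zero_iff two_ne_zero |>.1 (le_antisymm h0 (sq_nonneg _)))

theorem IsEssentiallyFree.isCanonical [LocallyCompactSpace G] {μ : Measure (unitSpace G)}
    [IsProbabilityMeasure μ] [μ.Regular] (hfree : IsEssentiallyFree μ)
    {τ : ReducedCStar G →L[ℂ] ℂ} (hτ : IsTracialState τ) (hμ : IsAssociatedMeasure τ μ) :
    IsCanonical τ := by
  refine ⟨μ, inferInstance, inferInstance, hμ, fun a => ?_⟩
  change τ a = canonicalTrace μ a
  refine congrFun (denseRange_toReduced.equalizer τ.continuous (canonicalTrace μ).continuous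
    (funext fun f => ?_)) a
  refine ConvAlg.local_induction
    (P := fun f => τ (toReduced G f) = canonicalTrace μ (toReduced G f)) ?_ ?_ f fun γ _ => ?_
  · rw [toReduced_zero, map_zero, map_zero]
  · intro f g hf hg
    rw [toReduced_add, map_add, map_add, hf, hg]
  by_cases hγ : γ ∈ unitSpace G
  -- `G⁰` is open and closed, so near a unit only functions in `C_c(G⁰)` occur, and the associated
  -- measure determines `τ` on them.
  · refine ⟨unitSpace G, isOpen_unitSpace, hγ, fun g hg _ => ?_⟩
    let h : C_c(unitSpace G, ℂ) := ⟨⟨fun x => g x, g.continuous.comp continuous_subtype_val⟩,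
      g.hasCompactSupport.comp_isClosedEmbedding isClosed_unitSpace.isClosedEmbedding_subtypeVal⟩
    have hgh : g = unitConv h := by
      ext η
      by_cases hη : η ∈ unitSpace G
      · exact (unitConv_coe h ⟨η, hη⟩).symm
      · rw [unitConv_of_notMem h hη]
        exact image_eq_zero_of_notMem_tsupport fun h' => hη (hg h')
    rw [canonicalTrace_toReduced, hgh, toReduced_unitConv, hμ]
    exact integral_congr_ae (Eventually.of_forall fun x => (unitConv_coe h x).symm)
  · obtain ⟨U, hU, hγU, hUb⟩ := exists_isOpen_bisection γ
    -- The interior of a compact neighbourhood supplies the pre-compact bisection off `G⁰` that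
    -- essential freeness requires.
    obtain ⟨K, hK, hγK, hKU⟩ := exists_compact_subset (hU.inter isClosed_unitSpace.isOpen_compl)
      (show γ ∈ U ∩ (unitSpace G)ᶜ from ⟨hγU, hγ⟩)
    refine ⟨interior K, isOpen_interior, hγK, fun g hg _ => ?_⟩
    have hsub := interior_subset.trans hKU
    have hb : IsBisection (interior K) :=
      hUb.mono isOpen_interior (hsub.trans Set.inter_subset_left)
    rw [eq_zero_of_fixedPoints_null μ hτ hμ hb (hfree _ isOpen_interior hb
      (hK.closure_of_subset interior_subset) (hsub.trans Set.inter_subset_right)) g hg,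
      canonicalTrace_toReduced]
    refine (integral_eq_zero_of_ae (Eventually.of_forall fun x => ?_)).symm
    exact image_eq_zero_of_notMem_tsupport fun h' => (hsub (hg h')).2 x.2

end canonical

/-! ### The representation of `C_c(G)` on `ℓ²(G⁰)` -/

section arrowSum
variable {G : Type*} [ArrowGroupoid G]

/-- The sum of `f(γ)` over all arrows `γ` from `z` to `y`. -/
def arrowSum (f : G → ℂ) (y z : unitSpace G) : ℂ :=
  ∑' γ : G, Set.indicator {γ | s γ = z ∧ r γ = y} f γ

lemma tsum_fiber {M : Type*} [AddCommMonoid M] [TopologicalSpace M] (F : G → M)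
    (z : unitSpace G) : ∑' γ : fiber z, F γ = ∑' γ : G, Set.indicator {γ | s γ = z} F γ :=
  tsum_subtype {γ | s γ = z} F

open Classical in
lemma arrowSum_eq_tsum_fiber (f : G → ℂ) (y z : unitSpace G) :
    arrowSum f y z = ∑' γ : fiber z, if r (γ : G) = y then f γ else 0 := by
  rw [tsum_fiber (fun γ => if r γ = y then f γ else 0), arrowSum]
  congr 1; ext γ
  by_cases h : s γ = z <;> by_cases h' : r γ = y <;> simp [h, h']

lemma arrowSum_eq_zero {f : G → ℂ} {U : Set G} (hf : ∀ γ ∉ U, f γ = 0) {y z : unitSpace G}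
    (h : ∀ γ ∈ U, s γ = z → r γ ≠ y) : arrowSum f y z = 0 := by
  rw [arrowSum]
  convert tsum_zero with γ
  refine Set.indicator_apply_eq_zero.2 fun hγ => hf γ fun hU => h γ hU hγ.1 hγ.2

lemma arrowSum_of_mem {f : G → ℂ} {U : Set G} (hf : ∀ γ ∉ U, f γ = 0) (hU : U.InjOn s)
    {γ : G} (hγ : γ ∈ U) : arrowSum f (r γ) (s γ) = f γ := by
  rw [arrowSum, tsum_eq_single γ]
  · exact Set.indicator_of_mem (s := {η | s η = s γ ∧ r η = r γ}) ⟨rfl, rfl⟩ f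
  · intro η hη
    refine Set.indicator_apply_eq_zero.2 fun h => hf η fun hηU => hη (hU hηU hγ h.1)

/-- Inversion exchanges the arrows from `z` to `y` with those from `y` to `z`. -/
lemma arrowSum_star (f : G → ℂ) (y z : unitSpace G) :
    arrowSum (fun γ => starRingEnd ℂ (f γ⁻¹)) y z = starRingEnd ℂ (arrowSum f z y) := by
  let e : G ≃ G := ⟨fun γ => γ⁻¹, fun γ => γ⁻¹, arrow_inv_inv, arrow_inv_inv⟩
  rw [arrowSum, arrowSum, Complex.conj_tsum, ← e.tsum_eq]
  congr 1; ext γ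
  change Set.indicator _ _ γ⁻¹ = _
  by_cases h : s γ = y ∧ r γ = z
  · rw [Set.indicator_of_mem (by simpa [s_inv, r_inv, and_comm] using h),
      Set.indicator_of_mem (by exact h), arrow_inv_inv]
  · rw [Set.indicator_of_notMem (by simpa [s_inv, r_inv, and_comm] using h),
      Set.indicator_of_notMem (by exact h), map_zero]

lemma enorm_arrowSum_le (f : G → ℂ) (y z : unitSpace G) :
    ‖arrowSum f y z‖ₑ ≤ ∑' γ : G, Set.indicator {γ | s γ = z ∧ r γ = y} (fun γ => ‖f γ‖ₑ) γ := by
  refine enorm_tsum_le_tsum_enorm.trans (le_of_eq ?_)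
  congr 1; ext γ
  exact enorm_indicator_eq_indicator_enorm _ _

/-- Every arrow in the fibre over `z` has exactly one range, so it is counted once when `y` varies.
Rows reduce to columns by `enorm_arrowSum_swap`, and together they make the matrix `arrowSum f` a
bounded operator. -/
lemma arrowSum_col (f : G → ℂ) (z : unitSpace G) :
    ∑' y, ‖arrowSum f y z‖ₑ ≤ ∑' γ : fiber z, ‖f γ‖ₑ := by
  refine (ENNReal.tsum_le_tsum fun y => enorm_arrowSum_le f y z).trans (le_of_eq ?_)
  rw [ENNReal.tsum_comm, tsum_fiber (fun γ => ‖f γ‖ₑ)]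
  congr 1; ext γ
  rw [tsum_eq_single (r γ)]
  · by_cases h : s γ = z <;> simp [h]
  · intro y hy
    exact Set.indicator_of_notMem (fun h => hy h.2.symm) _

lemma enorm_arrowSum_swap (f : G → ℂ) (y z : unitSpace G) :
    ‖arrowSum f y z‖ₑ = ‖arrowSum (fun γ => starRingEnd ℂ (f γ⁻¹)) z y‖ₑ := by
  rw [arrowSum_star]
  simp [enorm_eq_nnnorm]

lemma iNorm_arrowSum_col (f : G → ℂ) (z : unitSpace G) :
    ∑' y, ‖arrowSum f y z‖ₑ ≤ iNorm f :=
  (arrowSum_col f z).trans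
    ((le_iSup (fun x : unitSpace G => ∑' γ : fiber x, ‖f γ‖ₑ) z).trans (le_max_left _ _))

lemma iNorm_arrowSum_row (f : G → ℂ) (y : unitSpace G) :
    ∑' z, ‖arrowSum f y z‖ₑ ≤ iNorm f := by
  simp only [enorm_arrowSum_swap f y]
  exact (arrowSum_col _ y).trans
    ((le_iSup (fun x : unitSpace G => ∑' γ : fiber x, ‖starRingEnd ℂ (f (γ : G)⁻¹)‖ₑ) y).trans
      (le_max_right _ _))

variable [TopologicalSpace G] [IsEtale G]

lemma ConvAlg.tsum_fiber_eq_sum (g : ConvAlg G) (z : unitSpace G) (F : G → ℂ)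
    (hF : ∀ γ, g γ = 0 → F γ = 0) :
    ∑' γ : fiber z, F γ =
      ∑ γ ∈ (finite_fiber g.hasCompactSupport.isCompact z).toFinset, F γ := by
  rw [tsum_fiber, tsum_eq_sum]
  · refine Finset.sum_congr rfl fun γ hγ => ?_
    rw [Set.indicator_of_mem]
    exact ((Set.Finite.mem_toFinset _).1 hγ).2
  · intro γ hγ
    refine Set.indicator_apply_eq_zero.2 fun h => hF γ ?_
    exact image_eq_zero_of_notMem_tsupport fun h' =>
      hγ ((Set.Finite.mem_toFinset _).2 ⟨h', h⟩)

lemma ConvAlg.summable_fiber (f : ConvAlg G) (z : unitSpace G) (F : G → ℂ)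
    (hF : ∀ γ, f γ = 0 → F γ = 0) : Summable fun γ : fiber z => F γ := by
  refine summable_of_hasFiniteSupport (Set.Finite.subset
    ((finite_fiber f.hasCompactSupport.isCompact z).preimage Subtype.val_injective.injOn) ?_)
  intro γ hγ
  exact ⟨subset_tsupport _ fun h => hγ (hF _ h), γ.2⟩

/-- Convolution becomes matrix multiplication: a product `βα` from `z` to `y` is sorted by its
intermediate unit `w = r(α)`. -/
lemma arrowSum_mul [T2Space G] (f g : ConvAlg G) (y z : unitSpace G) :
    arrowSum (f * g : ConvAlg G) y z = ∑' w, arrowSum f y w * arrowSum g w z := by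
  classical
  set S := (finite_fiber g.hasCompactSupport.isCompact z).toFinset with hS
  have hSz : ∀ α ∈ S, s α = z := fun α hα => ((Set.Finite.mem_toFinset _).1 hα).2
  -- Both sides are compared with a finite sum over the arrows `α` of `supp g` with source `z`.
  trans ∑ α ∈ S, arrowSum f y (r α) * g α
  · have hmul : ∀ γ : fiber z, (f * g) (γ : G) = ∑ α ∈ S, f (γ * α⁻¹) * g α := by
      rintro ⟨γ, rfl⟩
      exact g.tsum_fiber_eq_sum (s γ) (fun α => f (γ * α⁻¹) * g α)
        fun α hα => by rw [hα, mul_zero]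
    have hcomp : ∀ α ∈ S, ∀ γ : fiber z, r ((γ : G) * α⁻¹) = r (γ : G) := fun α hα γ =>
      Subtype.ext (rng_mul _ _ (by rw [rng_inv]; exact s_eq_iff.1 (γ.2.trans (hSz α hα).symm)))
    -- Substitution `β = γα⁻¹`: right translation identifies the fibre over `z` with that over
    -- `r(α)` and preserves ranges.
    have hsum : ∀ α (hα : α ∈ S), (fun γ : fiber z => if r (γ : G) = y then f (γ * α⁻¹) else 0) =
        (fun β : fiber (r α) => if r (β : G) = y then f β else 0) ∘
          fiberEquiv ⟨α, hSz α hα⟩ := fun α hα => by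
      ext γ
      change _ = if r ((γ : G) * α⁻¹) = y then f ((γ : G) * α⁻¹) else 0
      rw [hcomp α hα]
    rw [arrowSum_eq_tsum_fiber]
    calc ∑' γ : fiber z, (if r (γ : G) = y then (f * g) (γ : G) else 0)
        = ∑' γ : fiber z, ∑ α ∈ S, (if r (γ : G) = y then f (γ * α⁻¹) else 0) * g α := by
          congr 1; ext γ
          rw [hmul]
          split_ifs <;> simp
      _ = ∑ α ∈ S, ∑' γ : fiber z, (if r (γ : G) = y then f (γ * α⁻¹) else 0) * g α := by
          refine Summable.tsum_finsetSum fun α hα => Summable.mul_right _ ?_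
          rw [hsum α hα, Equiv.summable_iff]
          exact f.summable_fiber (r α) (fun β => if r β = y then f β else 0)
            fun β hβ => by simp [hβ]
      _ = _ := by
          refine Finset.sum_congr rfl fun α hα => ?_
          rw [tsum_mul_right, arrowSum_eq_tsum_fiber, hsum α hα]
          congr 1
          exact Equiv.tsum_eq (fiberEquiv ⟨α, hSz α hα⟩)
            (fun β : fiber (r α) => if r (β : G) = y then f β else 0)
  · have hg : ∀ w, arrowSum g w z = ∑ α ∈ S, if r α = w then g α else 0 := fun w => by
      rw [arrowSum_eq_tsum_fiber]
      exact g.tsum_fiber_eq_sum z (fun α => if r α = w then g α else 0)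
        fun α hα => by simp [hα]
    have hz : ∀ (α : G) (w : unitSpace G), w ≠ r α →
        arrowSum f y w * (if r α = w then g α else 0) = 0 := fun α w hw => by
      rw [if_neg hw.symm, mul_zero]
    simp only [hg, Finset.mul_sum]
    rw [Summable.tsum_finsetSum fun α _ => (hasSum_single (r α) (hz α)).summable]
    refine Finset.sum_congr rfl fun α _ => ?_
    rw [tsum_eq_single (r α) (hz α), if_pos rfl]

end arrowSum

/-! ### The orbit representation and its vector functionals on `C*_r(G)` -/

section rep
universe u
variable {G : Type u} [TopologicalSpace G] [T2Space G] [ArrowGroupoid G] [IsEtale G]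

/-- The operator on `ℓ²(G⁰)` mapping `δ_x` to the sum of `f(γ) δ_{r(γ)}` over `γ ∈ G_x`. -/
def orbitOp (f : ConvAlg G) : ℓ²(unitSpace G, ℂ) →L[ℂ] ℓ²(unitSpace G, ℂ) :=
  kernelOp (arrowSum f) (iNorm f) f.iNorm_ne_top (iNorm_arrowSum_row f) (iNorm_arrowSum_col f)

lemma orbitOp_delta (f : ConvAlg G) (y z : unitSpace G) :
    orbitOp f (delta z) y = arrowSum f y z := kernelOp_delta _ _ _ _ _ _ _

lemma arrowSum_add (f g : ConvAlg G) (y z : unitSpace G) :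
    arrowSum (f + g : ConvAlg G) y z = arrowSum f y z + arrowSum g y z := by
  classical
  simp only [arrowSum_eq_tsum_fiber]
  rw [← Summable.tsum_add]
  · congr 1; ext γ
    split_ifs <;> simp
  · exact f.summable_fiber z (fun β => if r β = y then f β else 0) fun β hβ => by simp [hβ]
  · exact g.summable_fiber z (fun β => if r β = y then g β else 0) fun β hβ => by simp [hβ]

lemma arrowSum_smul (c : ℂ) (f : ConvAlg G) (y z : unitSpace G) :
    arrowSum (c • f : ConvAlg G) y z = c * arrowSum f y z := by
  classical
  simp only [arrowSum_eq_tsum_fiber]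
  rw [← tsum_mul_left]
  congr 1; ext γ
  split_ifs <;> simp

lemma orbitOp_smul (c : ℂ) (f : ConvAlg G) : orbitOp (c • f) = c • orbitOp f := by
  refine op_ext fun y z => ?_
  rw [_root_.smul_apply, lp.coeFn_smul, Pi.smul_apply, orbitOp_delta, orbitOp_delta,
    arrowSum_smul]
  rfl

lemma orbitOp_add (f g : ConvAlg G) : orbitOp (f + g) = orbitOp f + orbitOp g := by
  refine op_ext fun y z => ?_
  rw [_root_.add_apply, lp.coeFn_add, Pi.add_apply]
  simp only [orbitOp_delta, arrowSum_add]

lemma orbitOp_mul (f g : ConvAlg G) : orbitOp (f * g) = orbitOp f * orbitOp g := by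
  refine op_ext fun y z => ?_
  rw [mul_apply_eq_comp, orbitOp_delta, arrowSum_mul]
  conv_rhs => rw [orbitOp, kernelOp_apply]
  simp only [orbitOp_delta]

lemma orbitOp_star (f : ConvAlg G) : orbitOp (star f) = star (orbitOp f) := by
  refine op_ext fun y z => ?_
  rw [← inner_delta_left y (star (orbitOp f) (delta z)), ContinuousLinearMap.star_eq_adjoint,
    ContinuousLinearMap.adjoint_inner_right, inner_delta_right, orbitOp_delta, orbitOp_delta]
  exact arrowSum_star f y z

variable (G) in
/-- The representation of `C_c(G)` on `ℓ²(G⁰)`: the direct sum over the orbits of the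
quasi-regular representations. -/
def orbitRep : ContractiveRep G where
  H := ℓ²(unitSpace G, ℂ)
  π :=
    { toFun := orbitOp
      map_smul' := orbitOp_smul
      map_zero' := by simpa using orbitOp_smul (0 : ℂ) (0 : ConvAlg G)
      map_add' := orbitOp_add
      map_mul' := orbitOp_mul
      map_star' := orbitOp_star }
  contractive f := kernelOp_enorm_le (arrowSum f) (iNorm f) f.iNorm_ne_top
    (iNorm_arrowSum_row f) (iNorm_arrowSum_col f)

variable (G) in
/-- The extension of the representation on `ℓ²(G⁰)` to `C*(G)`. -/
def maximalOrbitRep :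
    MaximalCStar G →⋆ₙₐ[ℂ] (ℓ²(unitSpace G, ℂ) →L[ℂ] ℓ²(unitSpace G, ℂ)) where
  toFun a := a.1.coord (orbitRep G)
  map_smul' _ _ := rfl
  map_zero' := rfl
  map_add' _ _ := rfl
  map_mul' _ _ := rfl
  map_star' _ := rfl

/-- Under weak containment, `C*_r(G) → C*(G)` is inverse to the canonical quotient map. -/
def WeakContainment.lift (hG : WeakContainment G) : ReducedCStar G →⋆ₙₐ[ℂ] MaximalCStar G :=
  ((StarAlgEquiv.ofBijective (canonicalQuotient G) hG).symm :
    ReducedCStar G →⋆ₙₐ[ℂ] MaximalCStar G)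

lemma WeakContainment.lift_toReduced (hG : WeakContainment G) (f : ConvAlg G) :
    hG.lift (toReduced G f) = toMaximal G f := by
  refine (StarAlgEquiv.ofBijective (canonicalQuotient G) hG).symm_apply_eq.2 ?_
  exact (canonicalQuotient_toMaximal G f).symm

/-- The extension to `C*_r(G)` of the functional `f ↦ ∑ f(γ)`, the sum taken over the isotropy
group at `x`. -/
def isotropyFunctional (hG : WeakContainment G) (x : unitSpace G) : ReducedCStar G →L[ℂ] ℂ :=
  vectorFunctional ((maximalOrbitRep G).comp hG.lift) (delta x)

lemma isotropyFunctional_toReduced (hG : WeakContainment G) (x : unitSpace G) (f : ConvAlg G) :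
    isotropyFunctional hG x (toReduced G f) = arrowSum f x x := by
  rw [isotropyFunctional, vectorFunctional_apply, inner_delta_left,
    NonUnitalStarAlgHom.comp_apply, hG.lift_toReduced]
  exact orbitOp_delta f x x

lemma norm_isotropyFunctional_le (hG : WeakContainment G) (x : unitSpace G) :
    ‖isotropyFunctional hG x‖ ≤ 1 := by
  refine (norm_vectorFunctional_le _ _).trans ?_
  rw [norm_delta, one_mul]

lemma isotropyFunctional_nonneg (hG : WeakContainment G) (x : unitSpace G) (a : ReducedCStar G) :
    0 ≤ isotropyFunctional hG x (star a * a) :=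
  vectorFunctional_nonneg _ _ a

/-- The isotropy functional is computed only on `C_c(G)`. To reach all of `C_0(G⁰)`, approximants
that themselves vanish off `G⁰` are needed. -/
lemma unitInclusion_mem_closure (f : C₀(unitSpace G, ℂ)) :
    unitInclusion f ∈ closure (toReduced G '' {g | ∀ γ ∉ unitSpace G, g γ = 0}) := by
  rw [Metric.mem_closure_iff]
  intro ε hε
  obtain ⟨g, d, hd, hgd⟩ := exists_approx f (ε := ε / 4) (by positivity)
  refine ⟨toReduced G g, ⟨g, fun γ hγ => ?_, rfl⟩, ?_⟩
  · have := hgd γ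
    rw [extendZero_of_notMem _ hγ, extendZero_of_notMem _ hγ] at this
    simpa using this
  rw [dist_eq_norm]
  refine lt_of_le_of_lt (b := 2 * (ε / 4)) ?_ (by linarith)
  refine RegularProduct.norm_le (by positivity) fun x => ?_
  have hle : iNorm (extendZero d) ≤ ENNReal.ofReal (2 * (ε / 4)) :=
    iNorm_extendZero_le d _ fun y => by
      rw [← ofReal_norm]; exact ENNReal.ofReal_le_ofReal (hd y)
  have hne : iNorm (extendZero d) ≠ ∞ := ne_top_of_le_ne_top ENNReal.ofReal_ne_top hle
  have e : (unitFunFamily f - regularSum G g).coord x = regularOp x (extendZero d) hne := by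
    refine op_ext fun γ α => ?_
    rw [regularOp_delta, ← hgd]
    exact congrArg₂ (· - ·) (regularOp_delta x _ (iNorm_extendZero_ne_top f) γ α)
      (regOp_delta x g γ α)
  change ‖(unitFunFamily f - regularSum G g).coord x‖ ≤ _
  rw [e]
  have := (regularOp_enorm_le x (extendZero d) hne).trans hle
  rwa [← ofReal_norm, ENNReal.ofReal_le_ofReal_iff (by positivity)] at this

lemma norm_unitInclusion_le (f : C₀(unitSpace G, ℂ)) {C : ℝ} (hC : 0 ≤ C)
    (h : ∀ x, ‖f x‖ ≤ C) : ‖unitInclusion f‖ ≤ C := by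
  refine RegularProduct.norm_le hC fun x => ?_
  have := (regularOp_enorm_le x (extendZero f) (iNorm_extendZero_ne_top f)).trans
    (iNorm_extendZero_le f (ENNReal.ofReal C) fun y => by
      rw [← ofReal_norm]; exact ENNReal.ofReal_le_ofReal (h y))
  rwa [← ofReal_norm, ENNReal.ofReal_le_ofReal_iff hC] at this

/-- On functions in `C_c(G)` vanishing off `G⁰`, the isotropy sum at `x` and the expectation at `x`
are both evaluation at `x`; continuity extends the agreement to the closure. -/
lemma isotropyFunctional_unitInclusion (hG : WeakContainment G) (x : unitSpace G)
    (f : C₀(unitSpace G, ℂ)) : isotropyFunctional hG x (unitInclusion f) = f x := by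
  have h : Set.EqOn (isotropyFunctional hG x) (expectationAt x)
      (closure (toReduced G '' {g | ∀ γ ∉ unitSpace G, g γ = 0})) := by
    refine Set.EqOn.closure ?_ (isotropyFunctional hG x).continuous (expectationAt x).continuous
    rintro _ ⟨g, hg, rfl⟩
    rw [isotropyFunctional_toReduced, expectationAt_toReduced]
    have := arrowSum_of_mem (f := g) (U := unitSpace G) hg (fun a ha b hb hab => by
      have := s_eq_iff.1 hab
      rwa [show src a = a from ha, show src b = b from hb] at this) x.2
    rwa [r_unit, s_unit] at this
  rw [h (unitInclusion_mem_closure f)]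
  change inner ℂ (delta _) (regularOp x (extendZero f) (iNorm_extendZero_ne_top f) (delta _)) = _
  rw [inner_delta_left, regularOp_delta]
  change extendZero f ((x : G) * (x : G)⁻¹) = _
  rw [mul_inv_self, rng_unit, extendZero_coe]

end rep

/-! ### The trace given by an invariant measure and the isotropy groups -/

section bisection
variable {G : Type*} [TopologicalSpace G] [ArrowGroupoid G] [IsEtale G]

/-- Preimages and images of an open `V` are `s(B ∩ r⁻¹(V))` and `r(B ∩ s⁻¹(V))`, open because `s`
and `r` are open maps. -/
lemma isOpenEmbedding_bisectionMap {B : Set G} (hBo : IsOpen B) (hB : IsBisection B) :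
    IsOpenEmbedding (bisectionMap B) := by
  refine IsOpenEmbedding.of_continuous_injective_isOpenMap ?_ ?_ ?_
  · refine continuous_def.2 fun V hV => ?_
    have h : bisectionMap B ⁻¹' V = Subtype.val ⁻¹' (s '' (B ∩ r ⁻¹' V)) := by
      ext ⟨x, hx⟩
      obtain ⟨γ, hγ, rfl⟩ := id hx
      rw [Set.mem_preimage, bisectionMap_s hB hγ]
      refine ⟨fun h => ⟨γ, ⟨hγ, h⟩, rfl⟩, ?_⟩
      rintro ⟨η, ⟨hη, h⟩, hs⟩
      rwa [hB.injOn_s hη hγ hs] at h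
    rw [h]
    exact (isOpenMap_s _ (hBo.inter (hV.preimage continuous_r))).preimage continuous_subtype_val
  · rintro ⟨x, hx⟩ ⟨y, hy⟩ h
    obtain ⟨γ, hγ, rfl⟩ := id hx
    obtain ⟨η, hη, rfl⟩ := id hy
    rw [bisectionMap_s hB hγ, bisectionMap_s hB hη] at h
    exact Subtype.ext (congrArg s (hB.injOn_r hγ hη h))
  · rintro _ ⟨V, hV, rfl⟩
    have h : bisectionMap B '' (Subtype.val ⁻¹' V) = r '' (B ∩ s ⁻¹' V) := by
      ext y
      constructor
      · rintro ⟨⟨_, γ, hγ, rfl⟩, h, rfl⟩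
        exact ⟨γ, ⟨hγ, h⟩, (bisectionMap_s hB hγ _).symm⟩
      · rintro ⟨γ, ⟨hγ, h⟩, rfl⟩
        exact ⟨⟨s γ, γ, hγ, rfl⟩, h, bisectionMap_s hB hγ _⟩
    rw [h]
    exact isOpenMap_r _ (hBo.inter (hV.preimage continuous_s))

variable [MeasurableSpace (unitSpace G)] [BorelSpace (unitSpace G)]

/-- Change of variables along `α_B`. As `α_B` is a measurable embedding, no measurability of `a` and
`b` has to be checked. -/
lemma IsInvariant.integral_eq {μ : Measure (unitSpace G)} (hμ : IsInvariant μ) {B : Set G}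
    (hBo : IsOpen B) (hB : IsBisection B) {a b : unitSpace G → ℂ}
    (ha : ∀ x ∉ s '' B, a x = 0) (hb : ∀ x ∉ r '' B, b x = 0)
    (hab : ∀ γ ∈ B, a (s γ) = b (r γ)) : ∫ x, a x ∂μ = ∫ x, b x ∂μ := by
  calc ∫ x, a x ∂μ = ∫ x in s '' B, a x ∂μ :=
        (setIntegral_eq_integral_of_forall_compl_eq_zero ha).symm
    _ = ∫ x : s '' B, a x ∂(μ.comap Subtype.val) :=
        (integral_subtype_comap (isOpenMap_s B hBo).measurableSet a).symm
    _ = ∫ x : s '' B, b (bisectionMap B x) ∂(μ.comap Subtype.val) := by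
        refine integral_congr_ae (Eventually.of_forall ?_)
        rintro ⟨_, γ, hγ, rfl⟩
        exact (hab γ hγ).trans (congrArg b (bisectionMap_s hB hγ _).symm)
    _ = ∫ x in r '' B, b x ∂μ := by
        rw [hμ B hBo hB,
          (isOpenEmbedding_bisectionMap hBo hB).measurableEmbedding.integral_map]
    _ = ∫ x, b x ∂μ := setIntegral_eq_integral_of_forall_compl_eq_zero hb

/-- For `γ ∈ B` from `z` to `y`, the diagonal entry of `f * g` at `z` and that of `g * f` at `y` are
both the product of the `(z, y)` entry of `f` and the `(y, z)` entry of `g`. So `α_B` carries one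
integrand to the other, and invariance applies. -/
lemma integral_arrowSum_mul_comm [T2Space G] {μ : Measure (unitSpace G)} (hμ : IsInvariant μ)
    {B : Set G} (hBo : IsOpen B) (hB : IsBisection B) (f g : ConvAlg G)
    (hg : ∀ γ ∉ B, g γ = 0) :
    ∫ x, arrowSum (f * g : ConvAlg G) x x ∂μ = ∫ x, arrowSum (g * f : ConvAlg G) x x ∂μ := by
  refine hμ.integral_eq hBo hB (fun x hx => ?_) (fun x hx => ?_) fun γ hγ => ?_
  · rw [arrowSum_mul]
    convert tsum_zero with w
    rw [arrowSum_eq_zero (f := g) hg fun γ hγ h => (hx ⟨γ, hγ, h⟩).elim, mul_zero]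
  · rw [arrowSum_mul]
    convert tsum_zero with w
    rw [arrowSum_eq_zero (f := g) hg fun γ hγ _ h => (hx ⟨γ, hγ, h⟩).elim, zero_mul]
  -- As `s` and `r` are injective on `B`, the matrix of `g` has at most one nonzero entry in each
  -- row and column, so each sum over intermediate units has one term.
  · rw [arrowSum_mul, arrowSum_mul, tsum_eq_single (r γ), tsum_eq_single (s γ), mul_comm]
    · intro w hw
      rw [arrowSum_eq_zero (f := g) hg fun η hη h h' => hw ?_, zero_mul]
      rw [← h, hB.injOn_r hη hγ h']
    · intro w hw
      rw [arrowSum_eq_zero (f := g) hg fun η hη h h' => hw ?_, mul_zero]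
      rw [← h', hB.injOn_s hη hγ h]

/-- By injectivity of `s` on `B`, the fixed-point set is a difference of two open sets. -/
lemma measurableSet_fixedPoints [T2Space G] {B : Set G} (hBo : IsOpen B) (hB : IsBisection B) :
    MeasurableSet (fixedPoints B) := by
  have h : fixedPoints B = s '' B \ s '' (B ∩ {γ | s γ ≠ r γ}) := by
    ext x
    rw [mem_fixedPoints_iff hB]
    constructor
    · rintro ⟨γ, hγ, rfl, h⟩
      refine ⟨⟨γ, hγ, rfl⟩, ?_⟩
      rintro ⟨η, ⟨hη, h'⟩, hs⟩
      rw [hB.injOn_s hη hγ hs] at h'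
      exact h' h.symm
    · rintro ⟨⟨γ, hγ, rfl⟩, h⟩
      exact ⟨γ, hγ, rfl, by_contra fun h' => h ⟨γ, ⟨hγ, fun h => h' h.symm⟩, rfl⟩⟩
  rw [h]
  exact (isOpenMap_s B hBo).measurableSet.diff (isOpenMap_s _ (hBo.inter
    (isClosed_eq continuous_s continuous_r).isOpen_compl)).measurableSet

end bisection

/-! ### The isotropy trace and the implication (2) ⇒ (1) -/

section trace
universe u
variable {G : Type u} [TopologicalSpace G] [T2Space G] [LocallyCompactSpace G]
  [ArrowGroupoid G] [IsEtale G] [MeasurableSpace (unitSpace G)] [BorelSpace (unitSpace G)]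

/-- The isotropy sum need not be continuous in `x`. Measurability is checked on functions supported
in the domain of one local section of `s`, then spread by sums and limits. -/
lemma measurable_isotropyFunctional (hG : WeakContainment G) (a : ReducedCStar G) :
    Measurable fun x => isotropyFunctional hG x a := by
  classical
  refine measurable_apply_of_denseRange denseRange_toReduced (fun f => ?_) a
  refine ConvAlg.local_induction
    (P := fun f => Measurable fun x => isotropyFunctional hG x (toReduced G f)) ?_ ?_ f
    fun γ _ => ?_
  · simp only [toReduced_zero, map_zero]; exact measurable_const
  · intro f g hf hg
    simp only [toReduced_add, map_add]; exact hf.add hg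
  obtain ⟨e, he, hs⟩ := isLocalHomeomorph_s (G := G) γ
  refine ⟨e.source, e.open_source, he, fun g hg _ => ?_⟩
  have hg0 : ∀ η ∉ tsupport g, g η = 0 := fun η => image_eq_zero_of_notMem_tsupport
  set C : Set (unitSpace G) := s '' (tsupport g ∩ {η | s η = r η}) with hC
  have hCc : IsCompact C :=
    (g.hasCompactSupport.isCompact.inter_right (isClosed_eq continuous_s continuous_r)).image
      continuous_s
  have hinj : (tsupport g).InjOn s := by rw [hs]; exact e.injOn.mono hg
  -- At most one arrow of `supp g` lies over `x`. It contributes exactly when it is an isotropy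
  -- arrow, that is, when `x` lies in the compact set `C`.
  have h : (fun x => isotropyFunctional hG x (toReduced G g)) =
      C.piecewise (fun x => g (e.symm x)) 0 := by
    ext x
    rw [isotropyFunctional_toReduced]
    by_cases hx : x ∈ C
    · rw [Set.piecewise_eq_of_mem _ _ _ hx]
      obtain ⟨η, ⟨hη, hsr⟩, rfl⟩ := hx
      have h1 := arrowSum_of_mem hg0 hinj hη
      rw [← show s η = r η from hsr] at h1
      rw [h1, show s η = e η by rw [hs], e.left_inv (hg hη)]
    · rw [Set.piecewise_eq_of_notMem _ _ _ hx]
      exact arrowSum_eq_zero hg0 fun η hη h h' => hx ⟨η, ⟨hη, h.trans h'.symm⟩, h⟩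
  rw [h]
  refine ContinuousOn.measurable_piecewise ?_ continuousOn_const hCc.measurableSet
  refine g.continuous.comp_continuousOn (e.continuousOn_symm.mono ?_)
  rintro _ ⟨η, ⟨hη, -⟩, rfl⟩
  rw [hs]
  exact e.map_source (hg hη)

/-- The trace `f ↦ ∫ ∑_{γ ∈ G_x^x} f(γ) dμ(x)`. -/
def isotropyTrace (hG : WeakContainment G) (μ : Measure (unitSpace G)) [IsProbabilityMeasure μ] :
    ReducedCStar G →L[ℂ] ℂ :=
  integralFunctional μ (isotropyFunctional hG) (measurable_isotropyFunctional hG)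
    (norm_isotropyFunctional_le hG)

lemma isotropyTrace_apply (hG : WeakContainment G) (μ : Measure (unitSpace G))
    [IsProbabilityMeasure μ] (a : ReducedCStar G) :
    isotropyTrace hG μ a = ∫ x, isotropyFunctional hG x a ∂μ := rfl

lemma isotropyTrace_toReduced (hG : WeakContainment G) (μ : Measure (unitSpace G))
    [IsProbabilityMeasure μ] (f : ConvAlg G) :
    isotropyTrace hG μ (toReduced G f) = ∫ x, arrowSum f x x ∂μ := by
  simp only [isotropyTrace_apply, isotropyFunctional_toReduced]

lemma isAssociatedMeasure_isotropyTrace (hG : WeakContainment G) (μ : Measure (unitSpace G))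
    [IsProbabilityMeasure μ] : IsAssociatedMeasure (isotropyTrace hG μ) μ := fun f => by
  simp only [isotropyTrace_apply, isotropyFunctional_unitInclusion]

/-- By density and a partition of unity, one of the factors may be assumed supported in an open
bisection. -/
lemma isotropyTrace_mul_comm (hG : WeakContainment G) {μ : Measure (unitSpace G)}
    [IsProbabilityMeasure μ] (hμ : IsInvariant μ) (a b : ReducedCStar G) :
    isotropyTrace hG μ (a * b) = isotropyTrace hG μ (b * a) := by
  set τ := isotropyTrace hG μ
  have hτ := τ.continuous
  refine denseRange_toReduced.induction_on₂ (p := fun a b => τ (a * b) = τ (b * a)) ?_ ?_ a b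
  · exact isClosed_eq (hτ.comp (continuous_fst.mul continuous_snd))
      (hτ.comp (continuous_snd.mul continuous_fst))
  intro f g
  refine ConvAlg.local_induction (P := fun g => τ (toReduced G f * toReduced G g) =
    τ (toReduced G g * toReduced G f)) ?_ ?_ g fun γ _ => ?_
  · rw [toReduced_zero, mul_zero, zero_mul]
  · intro g g' hg hg'
    rw [toReduced_add, mul_add, add_mul, map_add, map_add, hg, hg']
  obtain ⟨U, hU, hγU, hUb⟩ := exists_isOpen_bisection γ
  refine ⟨U, hU, hγU, fun g hg _ => ?_⟩
  rw [← toReduced_mul, ← toReduced_mul, isotropyTrace_toReduced, isotropyTrace_toReduced]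
  exact integral_arrowSum_mul_comm hμ hU hUb f g
    fun η hη => image_eq_zero_of_notMem_tsupport fun h => hη (hg h)

/-- `G⁰` need not be compact, so there may be no unit to evaluate at. Instead `τ` is tested on
functions `0 ≤ χ ≤ 1` in `C_c(G⁰)` equal to `1` on compact sets of measure close to `1`. -/
lemma one_le_norm_of_isAssociatedMeasure {τ : ReducedCStar G →L[ℂ] ℂ}
    {μ : Measure (unitSpace G)} [IsProbabilityMeasure μ] [μ.Regular]
    (hτ : IsAssociatedMeasure τ μ) : 1 ≤ ‖τ‖ := by
  have : LocallyCompactSpace (unitSpace G) := isClosed_unitSpace.locallyCompactSpace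
  refine le_of_forall_lt fun c hc => ?_
  obtain ⟨c', hcc', hc'⟩ := exists_between hc
  obtain ⟨K, -, hK, hKc⟩ := MeasurableSet.univ.exists_lt_isCompact_of_ne_top
    (μ := μ) (measure_ne_top _ _) (r := ENNReal.ofReal c') (by
      rw [measure_univ, ← ENNReal.ofReal_one]
      exact (ENNReal.ofReal_lt_ofReal_iff one_pos).2 hc')
  obtain ⟨χ, hχ, hχc, -, hχ01⟩ := exists_continuousMap_one_of_isCompact_subset_isOpen hK
    isOpen_univ (Set.subset_univ _)
  let h : C_c(unitSpace G, ℂ) := ⟨⟨fun x => (χ x : ℂ), by fun_prop⟩,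
    HasCompactSupport.comp_left (g := ((↑) : ℝ → ℂ)) hχc Complex.ofReal_zero⟩
  have hχi : Integrable χ μ := χ.continuous.integrable_of_hasCompactSupport hχc
  have h1 : ‖τ (unitInclusion (toC0 h))‖ = ∫ x, χ x ∂μ := by
    rw [hτ]
    change ‖∫ x, (χ x : ℂ) ∂μ‖ = _
    rw [integral_complex_ofReal, Complex.norm_real,
      Real.norm_of_nonneg (integral_nonneg fun x => (hχ01 x).1)]
  have h2 : μ.real K ≤ ∫ x, χ x ∂μ := by
    have := integral_indicator_one (μ := μ) hK.measurableSet
    rw [← this]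
    refine integral_mono ((integrable_const (1 : ℝ)).indicator hK.measurableSet) hχi fun x => ?_
    by_cases hx : x ∈ K
    · rw [Set.indicator_of_mem hx, hχ hx]
    · rw [Set.indicator_of_notMem hx]; exact (hχ01 x).1
  have h3 : ‖unitInclusion (toC0 h)‖ ≤ 1 := norm_unitInclusion_le _ zero_le_one fun x => by
    change ‖(χ x : ℂ)‖ ≤ 1
    rw [Complex.norm_real, Real.norm_of_nonneg (hχ01 x).1]
    exact (hχ01 x).2
  have h4 : c' ≤ μ.real K := (ENNReal.ofReal_le_iff_le_toReal (measure_ne_top _ _)).1 hKc.le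
  calc c < c' := hcc'
    _ ≤ ‖τ (unitInclusion (toC0 h))‖ := by rw [h1]; exact h4.trans h2
    _ ≤ ‖τ‖ * ‖unitInclusion (toC0 h)‖ := τ.le_opNorm _
    _ ≤ ‖τ‖ := mul_le_of_le_one_right (norm_nonneg _) h3

lemma isTracialState_isotropyTrace (hG : WeakContainment G) {μ : Measure (unitSpace G)}
    [IsProbabilityMeasure μ] [μ.Regular] (hμ : IsInvariant μ) :
    IsTracialState (isotropyTrace hG μ) where
  nonneg a := by
    rw [isotropyTrace_apply]
    exact integral_nonneg fun x => isotropyFunctional_nonneg hG x a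
  norm_eq_one := le_antisymm (norm_integralFunctional_le _ _ _ _)
    (one_le_norm_of_isAssociatedMeasure (isAssociatedMeasure_isotropyTrace hG μ))
  tracial := isotropyTrace_mul_comm hG hμ

theorem measure_fixedPoints_eq_zero (hG : WeakContainment G) {μ : Measure (unitSpace G)}
    [IsProbabilityMeasure μ] [μ.Regular] (hcan : IsCanonical (isotropyTrace hG μ)) {B : Set G}
    (hBo : IsOpen B) (hB : IsBisection B) (hBu : B ⊆ (unitSpace G)ᶜ) :
    μ (fixedPoints B) = 0 := by
  by_contra hne
  obtain ⟨K, hKB, hK, hKpos⟩ := (measurableSet_fixedPoints hBo hB).exists_lt_isCompact_of_ne_top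
    (μ := μ) (measure_ne_top _ _) (pos_iff_ne_zero.2 hne)
  -- `L` is the set of arrows of `B` over `K`, compact because `s` restricts to an embedding of `B`
  -- whose image contains `K`.
  set L : Set G := Subtype.val '' ((fun γ : B => s (γ : G)) ⁻¹' K) with hL
  have hLc : IsCompact L := by
    refine IsCompact.image ?_ continuous_subtype_val
    refine (hB.1.isInducing.isCompact_preimage_iff fun x hx => ?_).2 hK
    obtain ⟨γ, hγ, h, -⟩ := (mem_fixedPoints_iff hB).1 (hKB hx)
    exact ⟨⟨γ, hγ⟩, h⟩
  obtain ⟨φ, hφ, hφc, hφB, hφ01⟩ := exists_continuousMap_one_of_isCompact_subset_isOpen hLc hBo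
    (by rintro _ ⟨γ, -, rfl⟩; exact γ.2)
  let f : ConvAlg G := ⟨⟨fun x => (φ x : ℂ), by fun_prop⟩,
    HasCompactSupport.comp_left (g := ((↑) : ℝ → ℂ)) hφc Complex.ofReal_zero⟩
  have hf : ∀ γ, f γ = φ γ := fun _ => rfl
  have hf0 : ∀ γ ∉ B, f γ = 0 := fun γ hγ => by
    rw [hf, image_eq_zero_of_notMem_tsupport fun h => hγ (hφB h)]; rfl
  -- At most one arrow of `B` lies over `x`, so the isotropy sum is zero or one value of `φ`. It is
  -- real and nonnegative, and equals `1` for `x ∈ K`.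
  have hsum : ∀ x, K.indicator 1 x ≤ (arrowSum f x x).re ∧
      arrowSum f x x = ((arrowSum f x x).re : ℂ) := fun x => by
    by_cases hx : x ∈ fixedPoints B
    · obtain ⟨γ, hγ, rfl, hr⟩ := (mem_fixedPoints_iff hB).1 hx
      have h := arrowSum_of_mem hf0 hB.injOn_s hγ
      rw [hr, hf] at h
      rw [h, Complex.ofReal_re]
      refine ⟨?_, rfl⟩
      by_cases hxK : s γ ∈ K
      · rw [Set.indicator_of_mem hxK, hφ ⟨⟨γ, hγ⟩, hxK, rfl⟩]; exact le_rfl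
      · rw [Set.indicator_of_notMem hxK]; exact (hφ01 γ).1
    · rw [Set.indicator_of_notMem fun h => hx (hKB h), arrowSum_eq_zero hf0
        fun γ hγ h h' => hx ((mem_fixedPoints_iff hB).2 ⟨γ, hγ, h, h'⟩)]
      simp
  have hint : Integrable (fun x => arrowSum f x x) μ := by
    have := integrable_apply μ (measurable_isotropyFunctional hG)
      (norm_isotropyFunctional_le hG) (toReduced G f)
    simpa only [isotropyFunctional_toReduced] using this
  have hpos : 0 < ∫ x, (arrowSum f x x).re ∂μ := by
    refine lt_of_lt_of_le (ENNReal.toReal_pos hKpos.ne' (measure_ne_top _ _)) ?_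
    have := integral_indicator_one (μ := μ) hK.measurableSet
    change μ.real K ≤ _
    rw [← this]
    exact integral_mono ((integrable_const (1 : ℝ)).indicator hK.measurableSet) hint.re
      fun x => (hsum x).1
  -- There is no need to identify `ν` with `μ`: since `f` vanishes on `G⁰`, its expectation
  -- integrates to `0` against any measure.
  obtain ⟨ν, hν, -, -, hcan⟩ := hcan
  have h0 := hcan (toReduced G f)
  rw [isotropyTrace_toReduced, traceOf] at h0
  simp only [unitExpectation_toReduced] at h0
  rw [integral_congr_ae (Eventually.of_forall fun x => (hsum x).2), integral_complex_ofReal,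
    integral_eq_zero_of_ae (Eventually.of_forall fun x : unitSpace G =>
      hf0 x fun h => hBu h x.2)] at h0
  exact hpos.ne' (Complex.ofReal_eq_zero.1 h0)

end trace

end GroupoidCStar
end

open GroupoidCStar MeasureTheory
theorem mainTheorem6 {G : Type*} [TopologicalSpace G] [T2Space G] [LocallyCompactSpace G]
    [ArrowGroupoid G] [IsEtale G] (hG : WeakContainment G)
    [MeasurableSpace (unitSpace G)] [BorelSpace (unitSpace G)]
    (μ : Measure (unitSpace G)) [IsProbabilityMeasure μ] [μ.Regular] (hμ : IsInvariant μ) :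
    IsEssentiallyFree μ ↔
      ∀ τ : ReducedCStar G →L[ℂ] ℂ,
        IsTracialState τ → IsAssociatedMeasure τ μ → IsCanonical τ :=
  -- In the converse, (2) is applied to the single trace `isotropyTrace hG μ`; this is where weak
  -- containment and invariance enter.
  ⟨fun h _ hτ hτμ => h.isCanonical hτ hτμ, fun h _ hBo hB _ hBu =>
    measure_fixedPoints_eq_zero hG (h _ (isTracialState_isotropyTrace hG hμ)
      (isAssociatedMeasure_isotropyTrace hG μ)) hBo hB hBu⟩
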